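/- Let $k$ be a field, let $H$ be a finite-dimensional Hopf algebra over $k$ with comultiplication $\Delta(h)=h_{(1)}\otimes h_{(2)}$, counit $\varepsilon$ and antipode $S$, and let $G(H)$ be the group of grouplike elements of $H$. Let $\mathcal{C}$ be the category of finite-dimensional left $H$-comodules, with coactions written $m\mapsto m_{(-1)}\otimes m_{(0)}$. Let $g_H\in G(H)$ be the distinguished grouplike element, i.e. the unique grouplike element with $h_{(1)}\lambda(h_{(2)})=\lambda(h)g_H$ for all $h\in H$ and all right cointegrals $\lambda$ on $H$ (linear maps $\lambda:H\to k$ with $\lambda(h_{(1)})h_{(2)}=\lambda(h)1$ for all $h\in H$). Let $\alpha_H:H\to k$ be the left modular function, i.e. the unique algebra map with $\Lambda h=\alpha_H(h)\Lambda$ for all $h\in H$ and all left integrals $\Lambda$ in $H$ (elements $\Lambda \in H$ with $h\Lambda=\varepsilon(h)\Lambda$ for all $h \in H$), and put $\overline{\alpha}_H=\alpha_H\circ S$. Let $A$ be an algebra in $\mathcal{C}$, that is, a finite-dimensional left $H$-comodule algebra, with coaction $\delta_A$. For $f\in H^*$ and $a\in A$ write $a\leftharpoonup f=f(a_{(-1)})\,a_{(0)}$.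 Suppose that there are $g_A\in G(H)$ and a non-degenerate $g_A$-cointegral $\lambda_A$ on $A$: a linear map $\lambda_A:A\to k$ such that $a_{(-1)}\lambda_A(a_{(0)})=\lambda_A(a)g_A$ for all $a\in A$ and such that the bilinear form $(a,b)\mapsto\lambda_A(ab)$ is non-degenerate. Let $\nu_A:A\to A$ be its Nakayama automorphism, determined by $\lambda_A(ba)=\lambda_A(\nu_A(a)b)$ for all $a,b\in A$. Let ${}_A\mathcal{C}_A$ be the category of $A$-bimodules in $\mathcal{C}$ (relative Hopf bimodules): finite-dimensional left $H$-comodules $M$ with commuting left and right $A$-actions such that the coaction of $H$ on $M$ satisfies $\delta(am)=\delta_A(a)\delta(m)$ and $\delta(ma)=\delta(m)\delta_A(a)$. Its Nakayama functor is $\mathrm{Nak}(M)=\int^{X\in{}_A\mathcal{C}_A}\mathrm{Hom}(M,X)^*\odot X$, where the integral denotes a coend and $V\odot X$ is the copower of $X$ by a finite-dimensional vector space $V$. The category ${}_A\mathcal{C}_A$ is called unimodular if $\mathrm{Nak}(A)\cong A$ in ${}_A\mathcal{C}_A$. Then ${}_A\mathcal{C}_A$ is unimodular if and only if there is an invertible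 element $g\in A$ such that $$g\,a=\nu_A^2(a\leftharpoonup\overline{\alpha}_H)\,g\quad\text{for all }a\in A,\qquad\text{and}\qquad \delta_A(g)=g_H^{-1}g_A^2\otimes g.$$ -/

import Mathlib

open scoped TensorProduct
open CategoryTheory

universe u

noncomputable section

/-- A left comodule over a coalgebra `H`, with coaction `m ↦ m₍₋₁₎ ⊗ m₍₀₎`. -/
class LeftComodule (k H M : Type u) [Field k] [AddCommGroup H] [Module k H] [Coalgebra k H]
    [AddCommGroup M] [Module k M] where
  /-- The coaction. -/
  coact (k H) : M →ₗ[k] H ⊗[k] M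
  coassoc : ∀ m, TensorProduct.assoc k H H M (Coalgebra.comul.rTensor M (coact m)) =
    coact.lTensor H (coact m)
  counit_coact : ∀ m, Coalgebra.counit.rTensor M (coact m) = (1 : k) ⊗ₜ[k] m

/-- A left comodule algebra over a Hopf algebra `H`: a left comodule `A` which is an algebra,
such that the coaction `A → H ⊗ A` is multiplicative and unital. -/
class LeftComoduleAlgebra (k H A : Type u) [Field k] [Ring H] [HopfAlgebra k H]
    [Ring A] [Algebra k A] extends LeftComodule k H A where
  coact_one : coact 1 = 1
  coact_mul : ∀ a b, coact (a * b) = coact a * coact b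

/-- A relative Hopf bimodule: a finite-dimensional left `H`-comodule `M` with commuting `k`-linear
actions of `A` (left) and `B` (right) such that the coaction of `H` satisfies
`δ(a m) = δ(a) δ(m)` and `δ(m b) = δ(m) δ(b)`. These are the `A`-`B`-bimodules in
the category of finite-dimensional left `H`-comodules. -/
structure RelHopfBimod (k H A B : Type u) [Field k] [Ring H] [HopfAlgebra k H]
    [Ring A] [Algebra k A] [LeftComoduleAlgebra k H A]
    [Ring B] [Algebra k B] [LeftComoduleAlgebra k H B] where
  carrier : Type u
  [addCommGroup : AddCommGroup carrier]
  [module : Module k carrier]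
  [finite : FiniteDimensional k carrier]
  [comodule : LeftComodule k H carrier]
  /-- The left action, `lact a m = a m`. -/
  lact : A →ₗ[k] carrier →ₗ[k] carrier
  /-- The right action, `ract b m = m b`. -/
  ract : B →ₗ[k] carrier →ₗ[k] carrier
  one_lact : ∀ m, lact 1 m = m
  mul_lact : ∀ a a' m, lact (a * a') m = lact a (lact a' m)
  one_ract : ∀ m, ract 1 m = m
  mul_ract : ∀ b b' m, ract (b * b') m = ract b' (ract b m)
  lact_ract : ∀ a b m, lact a (ract b m) = ract b (lact a m)
  coact_lact : ∀ a m, LeftComodule.coact k H (lact a m) =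
    TensorProduct.map₂ (LinearMap.mul k H) lact
      (LeftComodule.coact k H a) (LeftComodule.coact k H m)
  coact_ract : ∀ b m, LeftComodule.coact k H (ract b m) =
    TensorProduct.map₂ (LinearMap.mul k H).flip ract
      (LeftComodule.coact k H b) (LeftComodule.coact k H m)

namespace RelHopfBimod

attribute [instance] addCommGroup module finite comodule

theorem leftComm_map₂ {k H A V M : Type u} [Field k] [Ring H] [Algebra k H]
    [Ring A] [Algebra k A] [AddCommGroup V] [Module k V]
    [AddCommGroup M] [Module k M]
    (μ : H →ₗ[k] H →ₗ[k] H) (act : A →ₗ[k] M →ₗ[k] M) (v : V) (s : H ⊗[k] A) (t : H ⊗[k] M) :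
    TensorProduct.leftComm k V H M (v ⊗ₜ[k] TensorProduct.map₂ μ act s t) =
      TensorProduct.map₂ μ (LinearMap.lTensorHom V ∘ₗ act) s
        (TensorProduct.leftComm k V H M (v ⊗ₜ[k] t)) := by
  induction t with
  | zero => simp
  | add x y hx hy => simp only [TensorProduct.tmul_add, map_add, hx, hy]
  | tmul h y =>
    induction s with
    | zero => simp
    | add x y hx hy => simp only [TensorProduct.tmul_add, map_add, LinearMap.add_apply, hx, hy]
    | tmul h' a =>
      simp only [TensorProduct.map₂_apply_tmul, TensorProduct.map_tmul,
        TensorProduct.leftComm_tmul]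
      rfl

variable {k H A B : Type u} [Field k] [Ring H] [HopfAlgebra k H]
  [Ring A] [Algebra k A] [LeftComoduleAlgebra k H A]
  [Ring B] [Algebra k B] [LeftComoduleAlgebra k H B]

/-- The space of morphisms: the linear maps commuting with both actions and the coaction. -/
def homSubmodule (M N : RelHopfBimod k H A B) : Submodule k (M.carrier →ₗ[k] N.carrier) where
  carrier := {f | (∀ a m, f (M.lact a m) = N.lact a (f m)) ∧
    (∀ b m, f (M.ract b m) = N.ract b (f m)) ∧
    (∀ m, LeftComodule.coact k H (f m) = f.lTensor H (LeftComodule.coact k H m))}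
  zero_mem' := by simp
  add_mem' := by
    rintro f g ⟨h1, h2, h3⟩ ⟨h1', h2', h3'⟩
    refine ⟨?_, ?_, ?_⟩
    · intro a m; simp [h1, h1']
    · intro b m; simp [h2, h2']
    · intro m; simp [h3, h3', LinearMap.lTensor_add]
  smul_mem' := by
    rintro c f ⟨h1, h2, h3⟩
    refine ⟨?_, ?_, ?_⟩
    · intro a m; simp [h1]
    · intro b m; simp [h2]
    · intro m; simp [h3, LinearMap.lTensor_smul]

/-- The category of relative Hopf bimodules. -/
instance : Category (RelHopfBimod k H A B) where
  Hom M N := homSubmodule M N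
  id M := ⟨LinearMap.id, by simp [homSubmodule]⟩
  comp f g := ⟨g.1 ∘ₗ f.1, by
    refine ⟨?_, ?_, ?_⟩
    · intro a m; simp [f.2.1 a m, g.2.1]
    · intro b m; simp [f.2.2.1 b m, g.2.2.1]
    · intro m; simp [f.2.2.2 m, g.2.2.2, LinearMap.lTensor_comp]⟩

/-- The linear map underlying a morphism. -/
def toLin {M N : RelHopfBimod k H A B} (f : M ⟶ N) : M.carrier →ₗ[k] N.carrier := f.1

theorem hom_ext {M N : RelHopfBimod k H A B} {f g : M ⟶ N} (h : toLin f = toLin g) : f = g :=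
  Subtype.ext h

instance : Preadditive (RelHopfBimod k H A B) where
  homGroup M N := inferInstanceAs (AddCommGroup (homSubmodule M N))
  add_comp _ _ _ _ _ _ := hom_ext (LinearMap.comp_add _ _ _)
  comp_add _ _ _ _ _ _ := hom_ext (LinearMap.add_comp _ _ _)

instance : Linear k (RelHopfBimod k H A B) where
  homModule M N := inferInstanceAs (Module k (homSubmodule M N))
  smul_comp _ _ _ _ _ _ := hom_ext (LinearMap.comp_smul _ _ _)
  comp_smul _ _ _ _ _ _ := hom_ext (LinearMap.smul_comp _ _ _)

instance (M N : RelHopfBimod k H A B) : FiniteDimensional k (M ⟶ N) :=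
  inferInstanceAs (FiniteDimensional k (homSubmodule M N))

/-- The left `H`-comodule `V ⊗ M`, with coaction `v ⊗ m ↦ m₍₋₁₎ ⊗ (v ⊗ m₍₀₎)`. -/
@[reducible]
def copowerComodule (V M : Type u) [AddCommGroup V] [Module k V] [AddCommGroup M] [Module k M]
    [LeftComodule k H M] : LeftComodule k H (V ⊗[k] M) where
  coact := (TensorProduct.leftComm k V H M).toLinearMap ∘ₗ (LeftComodule.coact k H).lTensor V
  coassoc := by
    intro m
    induction m with
    | zero => simp
    | add x y hx hy => simp only [map_add, hx, hy]
    | tmul v x =>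
      have h := congrArg (fun t => (LinearMap.lTensor H
        (TensorProduct.leftComm k V H M).toLinearMap)
          (TensorProduct.leftComm k V H (H ⊗[k] M) (v ⊗ₜ[k] t)))
          (LeftComodule.coassoc (k := k) (H := H) x)
      simp only [LinearMap.comp_apply, LinearMap.lTensor_tmul, LinearEquiv.coe_coe]
      refine Eq.trans ?_ (h.trans ?_)
      · generalize LeftComodule.coact k H x = t
        induction t with
        | zero => simp
        | add x y hx hy => simp only [TensorProduct.tmul_add, map_add, hx, hy]
        | tmul a y =>
          simp only [TensorProduct.leftComm_tmul, LinearMap.rTensor_tmul]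
          generalize (Coalgebra.comul a : H ⊗[k] H) = t
          induction t with
          | zero => simp
          | add x y hx hy =>
            simp only [TensorProduct.tmul_add, TensorProduct.add_tmul, map_add, hx, hy]
          | tmul a b => simp
      · generalize LeftComodule.coact k H x = t
        induction t with
        | zero => simp
        | add x y hx hy => simp only [TensorProduct.tmul_add, map_add, hx, hy]
        | tmul a y => simp
  counit_coact := by
    intro m
    induction m with
    | zero => simp
    | add x y hx hy => simp only [map_add, hx, hy, TensorProduct.tmul_add]
    | tmul v x =>
      have h := congrArg (fun t => TensorProduct.leftComm k V k M (v ⊗ₜ[k] t))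
        (LeftComodule.counit_coact (k := k) (H := H) x)
      simp only [LinearMap.comp_apply, LinearMap.lTensor_tmul, LinearEquiv.coe_coe]
      refine Eq.trans ?_ (h.trans (by simp))
      generalize LeftComodule.coact k H x = t
      induction t with
      | zero => simp
      | add x y hx hy => simp only [TensorProduct.tmul_add, map_add, hx, hy]
      | tmul a y => simp

/-- The copower `V ⊙ M` of `M` by a finite-dimensional vector space `V`: the space `V ⊗ M` with
the structure coming from that of `M`. -/
abbrev copower (V : Type u) [AddCommGroup V] [Module k V] [FiniteDimensional k V]
    (M : RelHopfBimod k H A B) : RelHopfBimod k H A B where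
  carrier := V ⊗[k] M.carrier
  comodule := copowerComodule V M.carrier
  lact := LinearMap.lTensorHom V ∘ₗ M.lact
  ract := LinearMap.lTensorHom V ∘ₗ M.ract
  one_lact m := by
    have : M.lact 1 = LinearMap.id := LinearMap.ext M.one_lact
    simp [this]
  mul_lact a a' m := by
    have : M.lact (a * a') = M.lact a ∘ₗ M.lact a' := LinearMap.ext (M.mul_lact a a')
    simp [this, LinearMap.lTensor_comp]
  one_ract m := by
    have : M.ract 1 = LinearMap.id := LinearMap.ext M.one_ract
    simp [this]
  mul_ract b b' m := by
    have : M.ract (b * b') = M.ract b' ∘ₗ M.ract b := LinearMap.ext (M.mul_ract b b')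
    simp [this, LinearMap.lTensor_comp]
  lact_ract a b m := by
    have : M.lact a ∘ₗ M.ract b = M.ract b ∘ₗ M.lact a := LinearMap.ext (M.lact_ract a b)
    have h := congrArg (fun f => LinearMap.lTensor V f m) this
    rw [LinearMap.lTensor_comp, LinearMap.lTensor_comp] at h
    exact h
  coact_lact a m := by
    induction m with
    | zero => simp only [map_zero]
    | add x y hx hy => rw [map_add, map_add, map_add, map_add, hx, hy]
    | tmul v x =>
      exact (congrArg (fun t => TensorProduct.leftComm k V H M.carrier (v ⊗ₜ[k] t))
        (M.coact_lact a x)).trans (leftComm_map₂ _ _ _ _ _)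
  coact_ract b m := by
    induction m with
    | zero => simp only [map_zero]
    | add x y hx hy => rw [map_add, map_add, map_add, map_add, hx, hy]
    | tmul v x =>
      exact (congrArg (fun t => TensorProduct.leftComm k V H M.carrier (v ⊗ₜ[k] t))
        (M.coact_ract b x)).trans (leftComm_map₂ _ _ _ _ _)

/-- Functoriality of the copower in both variables. -/
def copowerMap {V W : Type u} [AddCommGroup V] [Module k V] [FiniteDimensional k V]
    [AddCommGroup W] [Module k W] [FiniteDimensional k W]
    {M N : RelHopfBimod k H A B} (φ : V →ₗ[k] W) (f : M ⟶ N) : copower V M ⟶ copower W N :=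
  ⟨TensorProduct.map φ (toLin f), by
    refine ⟨fun a m => ?_, fun b m => ?_, fun m => ?_⟩
    · have h : toLin f ∘ₗ M.lact a = N.lact a ∘ₗ toLin f := LinearMap.ext (f.2.1 a)
      change (TensorProduct.map φ (toLin f) ∘ₗ LinearMap.lTensor V (M.lact a)) m =
        (LinearMap.lTensor W (N.lact a) ∘ₗ TensorProduct.map φ (toLin f)) m
      rw [LinearMap.map_comp_lTensor, LinearMap.lTensor_comp_map, h]
    · have h : toLin f ∘ₗ M.ract b = N.ract b ∘ₗ toLin f := LinearMap.ext (f.2.2.1 b)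
      change (TensorProduct.map φ (toLin f) ∘ₗ LinearMap.lTensor V (M.ract b)) m =
        (LinearMap.lTensor W (N.ract b) ∘ₗ TensorProduct.map φ (toLin f)) m
      rw [LinearMap.map_comp_lTensor, LinearMap.lTensor_comp_map, h]
    · change V ⊗[k] M.carrier at m
      induction m with
      | zero => simp only [map_zero]
      | add x y hx hy => rw [map_add, map_add, map_add, map_add, hx, hy]
      | tmul v x =>
        have h := congrArg (fun t => TensorProduct.leftComm k W H N.carrier (φ v ⊗ₜ[k] t))
          (f.2.2.2 x)
        refine h.trans ?_
        change _ = (TensorProduct.map φ (toLin f)).lTensor H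
          (TensorProduct.leftComm k V H M.carrier (v ⊗ₜ[k] LeftComodule.coact k H x))
        generalize LeftComodule.coact k H x = t
        induction t with
        | zero => simp
        | add x y hx hy => simp only [TensorProduct.tmul_add, map_add, hx, hy]
        | tmul h y => simp [toLin]⟩

theorem toLin_copowerMap {V W : Type u} [AddCommGroup V] [Module k V] [FiniteDimensional k V]
    [AddCommGroup W] [Module k W] [FiniteDimensional k W]
    {M N : RelHopfBimod k H A B} (φ : V →ₗ[k] W) (f : M ⟶ N) :
    toLin (copowerMap φ f) = TensorProduct.map φ (toLin f) := rfl

theorem copowerMap_id {V : Type u} [AddCommGroup V] [Module k V] [FiniteDimensional k V]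
    (M : RelHopfBimod k H A B) : copowerMap (LinearMap.id : V →ₗ[k] V) (𝟙 M) = 𝟙 _ :=
  hom_ext TensorProduct.map_id

theorem copowerMap_comp {V W U : Type u} [AddCommGroup V] [Module k V] [FiniteDimensional k V]
    [AddCommGroup W] [Module k W] [FiniteDimensional k W]
    [AddCommGroup U] [Module k U] [FiniteDimensional k U]
    {L M N : RelHopfBimod k H A B} (φ : V →ₗ[k] W) (ψ : W →ₗ[k] U) (f : L ⟶ M) (g : M ⟶ N) :
    copowerMap φ f ≫ copowerMap ψ g = copowerMap (ψ ∘ₗ φ) (f ≫ g) :=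
  hom_ext (TensorProduct.map_comp ψ (toLin g) φ (toLin f)).symm

/-- The defining adjunction of the copower: `Hom(V ⊙ M, N) ≃ Hom_k(V, Hom(M, N))`. -/
def copowerHomEquiv (V : Type u) [AddCommGroup V] [Module k V] [FiniteDimensional k V]
    (M N : RelHopfBimod k H A B) : (copower V M ⟶ N) ≃ (V →ₗ[k] (M ⟶ N)) where
  toFun f :=
    { toFun v := ⟨toLin f ∘ₗ TensorProduct.mk k V M.carrier v, by
        refine ⟨fun a m => f.2.1 a (v ⊗ₜ[k] m), fun b m => f.2.2.1 b (v ⊗ₜ[k] m), fun m => ?_⟩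
        refine (f.2.2.2 (v ⊗ₜ[k] m)).trans ?_
        change (toLin f).lTensor H
          (TensorProduct.leftComm k V H M.carrier (v ⊗ₜ[k] LeftComodule.coact k H m)) = _
        generalize LeftComodule.coact k H m = t
        induction t with
        | zero => simp
        | add x y hx hy => simp only [TensorProduct.tmul_add, map_add, hx, hy]
        | tmul h y => simp⟩
      map_add' v w := hom_ext (LinearMap.ext fun m =>
        (congrArg (toLin f) (TensorProduct.add_tmul v w m)).trans ((toLin f).map_add _ _))
      map_smul' c v := hom_ext (LinearMap.ext fun m =>
        (congrArg (toLin f) (TensorProduct.smul_tmul' c v m).symm).trans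
          ((toLin f).map_smul _ _)) }
  invFun F := ⟨TensorProduct.lift ((homSubmodule M N).subtype ∘ₗ F), by
    refine ⟨fun a m => ?_, fun b m => ?_, fun m => ?_⟩
    · change V ⊗[k] M.carrier at m
      induction m with
      | zero => simp only [map_zero]
      | add x y hx hy => rw [map_add, map_add, map_add, map_add, hx, hy]
      | tmul v x => exact (F v).2.1 a x
    · change V ⊗[k] M.carrier at m
      induction m with
      | zero => simp only [map_zero]
      | add x y hx hy => rw [map_add, map_add, map_add, map_add, hx, hy]
      | tmul v x => exact (F v).2.2.1 b x
    · change V ⊗[k] M.carrier at m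
      induction m with
      | zero => simp only [map_zero]
      | add x y hx hy => rw [map_add, map_add, map_add, map_add, hx, hy]
      | tmul v x =>
        refine ((F v).2.2.2 x).trans ?_
        change _ = LinearMap.lTensor H _
          (TensorProduct.leftComm k V H M.carrier (v ⊗ₜ[k] LeftComodule.coact k H x))
        generalize LeftComodule.coact k H x = t
        induction t with
        | zero => simp
        | add x y hx hy => simp only [TensorProduct.tmul_add, map_add, hx, hy]
        | tmul h y => simp⟩
  left_inv f := hom_ext (TensorProduct.ext' fun _ _ => rfl)
  right_inv F := LinearMap.ext fun v => hom_ext (LinearMap.ext fun m => rfl)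

/-- The linear map `Hom(M, Y)^* → Hom(M, X)^*` dual to composition with `f : X ⟶ Y`. -/
def dualComp (M : RelHopfBimod k H A B) {X Y : RelHopfBimod k H A B} (f : X ⟶ Y) :
    Module.Dual k (M ⟶ Y) →ₗ[k] Module.Dual k (M ⟶ X) :=
  (Linear.rightComp k M f).dualMap

theorem dualComp_id (M X : RelHopfBimod k H A B) : dualComp M (𝟙 X) = LinearMap.id :=
  LinearMap.ext fun ξ => LinearMap.ext fun h => congrArg ξ (Category.comp_id h)

theorem dualComp_comp (M : RelHopfBimod k H A B) {X Y Z : RelHopfBimod k H A B}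
    (f : X ⟶ Y) (g : Y ⟶ Z) : dualComp M (f ≫ g) = dualComp M f ∘ₗ dualComp M g :=
  LinearMap.ext fun ξ => LinearMap.ext fun h => congrArg ξ (Category.assoc h f g).symm

/-- The functor `(X, Y) ↦ Hom(M, X)^* ⊙ Y`, contravariant in `X` and covariant in `Y`. -/
def nakayamaBifunctor (M : RelHopfBimod k H A B) :
    (RelHopfBimod k H A B)ᵒᵖ ⥤ RelHopfBimod k H A B ⥤ RelHopfBimod k H A B where
  obj X :=
    { obj Y := copower (Module.Dual k (M ⟶ X.unop)) Y
      map f := copowerMap LinearMap.id f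
      map_id Y := copowerMap_id Y
      map_comp f g := by rw [copowerMap_comp, LinearMap.id_comp] }
  map f :=
    { app Y := copowerMap (dualComp M f.unop) (𝟙 Y)
      naturality Y Z g := by
        rw [copowerMap_comp, copowerMap_comp, Category.comp_id, Category.id_comp]
        rfl }
  map_id X := by
    ext Y
    change copowerMap (dualComp M (𝟙 X.unop)) (𝟙 Y) = 𝟙 _
    rw [dualComp_id, copowerMap_id]
  map_comp f g := by
    ext Y
    change copowerMap (dualComp M (g.unop ≫ f.unop)) (𝟙 Y) =
      copowerMap (dualComp M f.unop) (𝟙 Y) ≫ copowerMap (dualComp M g.unop) (𝟙 Y)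
    rw [dualComp_comp, copowerMap_comp, Category.comp_id]

/-- `N` is the value at `M` of the Nakayama functor, i.e. `N` is (isomorphic to) the coend of
`(X, Y) ↦ Hom(M, X)^* ⊙ Y`. -/
def IsNakayama (M N : RelHopfBimod k H A B) : Prop :=
  ∃ c : Limits.Cowedge (nakayamaBifunctor M),
    Nonempty (Limits.IsColimit c) ∧ Nonempty (c.pt ≅ N)

variable (k H A) in
/-- The unit object `A` of the category of relative Hopf bimodules over `A`, `A`. -/
def unitObj [FiniteDimensional k A] : RelHopfBimod k H A A where
  carrier := A
  lact := LinearMap.mul k A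
  ract := (LinearMap.mul k A).flip
  one_lact := by simp
  mul_lact := by simp [mul_assoc]
  one_ract := by simp
  mul_ract := by simp [mul_assoc]
  lact_ract := by simp [mul_assoc]
  coact_lact a m := by
    rw [LinearMap.mul_apply', LeftComoduleAlgebra.coact_mul]
    generalize LeftComodule.coact k H m = t
    generalize LeftComodule.coact k H a = s
    induction s with
    | zero => simp
    | add x y hx hy => simp only [add_mul, map_add, LinearMap.add_apply, hx, hy]
    | tmul h x =>
      induction t with
      | zero => simp
      | add x y hx hy => simp only [mul_add, map_add, hx, hy]
      | tmul h' x' => simp [TensorProduct.map₂_apply_tmul]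
  coact_ract b m := by
    rw [LinearMap.flip_apply, LinearMap.mul_apply', LeftComoduleAlgebra.coact_mul]
    generalize LeftComodule.coact k H m = t
    generalize LeftComodule.coact k H b = s
    induction s with
    | zero => simp
    | add x y hx hy => simp only [mul_add, map_add, LinearMap.add_apply, hx, hy]
    | tmul h x =>
      induction t with
      | zero => simp
      | add x y hx hy => simp only [add_mul, map_add, hx, hy]
      | tmul h' x' => simp [TensorProduct.map₂_apply_tmul]

end RelHopfBimod

namespace HopfIntegral
open Coalgebra HopfAlgebra

section
variable {k H : Type u} [Field k] [Ring H] [HopfAlgebra k H]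

/-- `hitL f h = h ↼ f = f(h₍₁₎) h₍₂₎`. -/
def hitL (f : H →ₗ[k] k) : H →ₗ[k] H :=
  (TensorProduct.lid k H).toLinearMap ∘ₗ f.rTensor H ∘ₗ comul

/-- `hitR f h = f ⇀ h = h₍₁₎ f(h₍₂₎)`. -/
def hitR (f : H →ₗ[k] k) : H →ₗ[k] H :=
  (TensorProduct.rid k H).toLinearMap ∘ₗ f.lTensor H ∘ₗ comul

theorem hitL_eq {ι : Type*} {h : H} (r : Repr k h ι) (f : H →ₗ[k] k) :
    hitL f h = ∑ i ∈ r.index, f (r.left i) • r.right i := by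
  simp [hitL, ← r.eq]

theorem hitR_eq {ι : Type*} {h : H} (r : Repr k h ι) (f : H →ₗ[k] k) :
    hitR f h = ∑ i ∈ r.index, f (r.right i) • r.left i := by
  simp [hitR, ← r.eq]

/-- Coassociativity applied to a linear map out of the triple tensor product. -/
theorem coassoc_sum {V : Type*} [AddCommGroup V] [Module k V]
    (T : H ⊗[k] (H ⊗[k] H) →ₗ[k] V) (h : H) :
    ∑ i ∈ (ℛ k h).index, ∑ j ∈ (ℛ k ((ℛ k h).left i)).index,
      T ((ℛ k ((ℛ k h).left i)).left j ⊗ₜ ((ℛ k ((ℛ k h).left i)).right j ⊗ₜ (ℛ k h).right i)) =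
    ∑ i ∈ (ℛ k h).index, ∑ j ∈ (ℛ k ((ℛ k h).right i)).index,
      T ((ℛ k h).left i ⊗ₜ ((ℛ k ((ℛ k h).right i)).left j ⊗ₜ
        (ℛ k ((ℛ k h).right i)).right j)) := by
  have := congrArg T (sum_tmul_tmul_eq (ℛ k h) (fun i => ℛ k ((ℛ k h).left i))
    (fun i => ℛ k ((ℛ k h).right i)))
  simpa only [map_sum] using this

theorem hitL_hitL (f g : H →ₗ[k] k) (h : H) : hitL (f ∘ₗ hitR g) h = hitL g (hitL f h) := by
  have := coassoc_sum ((TensorProduct.lid k H).toLinearMap ∘ₗ TensorProduct.map f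
    ((TensorProduct.lid k H).toLinearMap ∘ₗ g.rTensor H)) h
  rw [hitL_eq (ℛ k h), hitL_eq (ℛ k h) f]
  simp only [map_sum, map_smul, LinearMap.comp_apply]
  simp only [fun x => hitR_eq (ℛ k x) g, fun x => hitL_eq (ℛ k x) g, map_sum, map_smul,
    Finset.sum_smul, Finset.smul_sum]
  simpa [smul_smul, mul_comm] using this

theorem hitL_hitR (f g : H →ₗ[k] k) (h : H) : hitL f (hitR g h) = hitR g (hitL f h) := by
  have := coassoc_sum ((TensorProduct.lid k H).toLinearMap ∘ₗ TensorProduct.map f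
    ((TensorProduct.rid k H).toLinearMap ∘ₗ g.lTensor H)) h
  rw [hitR_eq (ℛ k h), hitL_eq (ℛ k h) f]
  simp only [map_sum, map_smul]
  simp only [fun x => hitL_eq (ℛ k x) f, fun x => hitR_eq (ℛ k x) g, Finset.smul_sum]
  simpa [smul_smul, mul_comm] using this

theorem comul_antipode (h : H) :
    (comul (antipode k h) : H ⊗[k] H) =
      TensorProduct.map (antipode k) (antipode k) (TensorProduct.comm k H H (comul h)) := by
  have key : WithConv.toConv (TensorProduct.map (antipode k) (antipode k) ∘ₗ
      (TensorProduct.comm k H H).toLinearMap ∘ₗ comul) *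
      WithConv.toConv (comul : H →ₗ[k] H ⊗[k] H) = 1 := by
    ext c
    rw [(ℛ k c).convMul_apply]
    have h1 := coassoc_sum (LinearMap.mul' k (H ⊗[k] H) ∘ₗ
      TensorProduct.map (TensorProduct.map (antipode k) (antipode k) ∘ₗ
        (TensorProduct.comm k H H).toLinearMap) comul ∘ₗ
      (TensorProduct.assoc k H H H).symm.toLinearMap) c
    have h2 : ∀ u v : H, ∑ j ∈ (ℛ k v).index,
        (antipode k ((ℛ k v).left j) ⊗ₜ[k] antipode k u) * comul ((ℛ k v).right j) =
        1 ⊗ₜ[k] (antipode k u * v) := by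
      intro u v
      have h3 := coassoc_sum (TensorProduct.map (LinearMap.mul' k H ∘ₗ
        (antipode k).rTensor H) (LinearMap.mulLeft k (antipode k u)) ∘ₗ
        (TensorProduct.assoc k H H H).symm.toLinearMap) v
      simp only [LinearMap.comp_apply, LinearEquiv.coe_coe, TensorProduct.assoc_symm_tmul,
        TensorProduct.map_tmul, LinearMap.rTensor_tmul, LinearMap.mul'_apply,
        LinearMap.mulLeft_apply] at h3
      simp only [← TensorProduct.sum_tmul, sum_antipode_mul_eq_smul] at h3
      simp only [TensorProduct.smul_tmul, ← mul_smul_comm, ← TensorProduct.tmul_sum,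
        ← Finset.mul_sum, sum_counit_smul] at h3
      rw [h3]
      refine Finset.sum_congr rfl fun j _ => ?_
      conv_lhs => rw [← (ℛ k ((ℛ k v).right j)).eq]
      simp [Finset.mul_sum]
    simp only [LinearMap.comp_apply, LinearEquiv.coe_coe, TensorProduct.assoc_symm_tmul,
      TensorProduct.map_tmul, LinearMap.mul'_apply, TensorProduct.comm_tmul, h2] at h1
    rw [← TensorProduct.tmul_sum, sum_antipode_mul_eq_smul] at h1
    refine Eq.trans ?_ (h1.trans ?_)
    · refine Finset.sum_congr rfl fun j _ => ?_
      conv_lhs => rw [WithConv.ofConv_toConv, LinearMap.comp_apply, LinearMap.comp_apply,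
        ← (ℛ k ((ℛ k c).left j)).eq]
      simp [Finset.sum_mul]
    · simp [Algebra.algebraMap_eq_smul_one, Algebra.TensorProduct.one_def]
  have := left_inv_eq_right_inv key LinearMap.comul_right_inv
  exact (congrArg (fun f : WithConv (H →ₗ[k] H ⊗[k] H) => f.ofConv h) this).symm

/-- A right cointegral on `H`: a linear form with `λ(h₍₁₎) h₍₂₎ = λ(h) 1`. -/
def IsRightCointegral (lam : H →ₗ[k] k) : Prop := ∀ h, hitL lam h = lam h • (1 : H)

/-- A left integral in `H`: an element with `h Λ = ε(h) Λ`. -/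
def IsLeftIntegral (k : Type u) {H : Type u} [Field k] [Ring H] [HopfAlgebra k H] (Lam : H) :
    Prop := ∀ h : H, h * Lam = (counit h : k) • Lam

theorem sum_smul_right_basis [FiniteDimensional k H] {V : Type*} [AddCommGroup V] [Module k V]
    (T : H →ₗ[k] V) (y : H) :
    ∑ j, (Module.finBasis k H).coord j y • T (Module.finBasis k H j) = T y := by
  conv_rhs => rw [← (Module.finBasis k H).sum_repr y]
  simp [map_sum, -Module.Basis.sum_repr]

theorem sum_hitR_hitR [FiniteDimensional k H] (p : H →ₗ[k] k) (y : H) :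
    ∑ j, hitR ((Module.finBasis k H).coord j)
      (hitR (p ∘ₗ LinearMap.mulLeft k (antipode k (Module.finBasis k H j))) y) = p 1 • y := by
  have h1 := fun j => coassoc_sum ((TensorProduct.rid k H).toLinearMap ∘ₗ
    TensorProduct.map LinearMap.id (LinearMap.mul' k k ∘ₗ TensorProduct.map
      ((Module.finBasis k H).coord j)
      (p ∘ₗ LinearMap.mulLeft k (antipode k (Module.finBasis k H j))))) y
  have h2 : ∀ j, hitR ((Module.finBasis k H).coord j)
      (hitR (p ∘ₗ LinearMap.mulLeft k (antipode k (Module.finBasis k H j))) y) =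
      ∑ i ∈ (ℛ k y).index, ∑ l ∈ (ℛ k ((ℛ k y).right i)).index,
        ((Module.finBasis k H).coord j ((ℛ k ((ℛ k y).right i)).left l) *
          p (antipode k (Module.finBasis k H j) * (ℛ k ((ℛ k y).right i)).right l)) •
          (ℛ k y).left i := by
    intro j
    have := h1 j
    simp only [LinearMap.comp_apply, LinearEquiv.coe_coe, TensorProduct.map_tmul,
      LinearMap.id_apply, TensorProduct.rid_tmul, LinearMap.mul'_apply,
      LinearMap.mulLeft_apply] at this
    rw [← this, hitR_eq (ℛ k y), map_sum]
    simp only [map_smul]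
    simp only [fun x => hitR_eq (ℛ k x) ((Module.finBasis k H).coord j),
      Finset.smul_sum, smul_smul, LinearMap.comp_apply, LinearMap.mulLeft_apply]
    exact Finset.sum_congr rfl fun i _ => Finset.sum_congr rfl fun l _ => by rw [mul_comm]
  rw [Finset.sum_congr rfl fun j _ => h2 j, Finset.sum_comm]
  have h3 : ∀ v : H, ∑ j, ∑ l ∈ (ℛ k v).index,
      ((Module.finBasis k H).coord j ((ℛ k v).left l) *
          p (antipode k (Module.finBasis k H j) * (ℛ k v).right l)) = (counit v : k) * p 1 := by
    intro v
    rw [Finset.sum_comm]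
    have h4 : ∀ l, ∑ j, ((Module.finBasis k H).coord j ((ℛ k v).left l) *
          p (antipode k (Module.finBasis k H j) * (ℛ k v).right l)) =
          p (antipode k ((ℛ k v).left l) * (ℛ k v).right l) := fun l =>
      sum_smul_right_basis (p ∘ₗ LinearMap.mulRight k ((ℛ k v).right l) ∘ₗ antipode k) _
    rw [Finset.sum_congr rfl fun l _ => h4 l, ← map_sum, sum_antipode_mul_eq_smul, map_smul,
      smul_eq_mul]
  have h5 : ∀ i, ∑ j, ∑ l ∈ (ℛ k ((ℛ k y).right i)).index,
        ((Module.finBasis k H).coord j ((ℛ k ((ℛ k y).right i)).left l) *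
          p (antipode k (Module.finBasis k H j) * (ℛ k ((ℛ k y).right i)).right l)) •
          (ℛ k y).left i = p 1 • ((counit ((ℛ k y).right i) : k) • (ℛ k y).left i) := by
    intro i
    simp only [← Finset.sum_smul, h3, smul_smul, mul_comm]
  rw [Finset.sum_congr rfl fun i _ => h5 i, ← Finset.smul_sum]
  have h6 := congrArg (TensorProduct.rid k H) (sum_tmul_counit_eq (R := k) (ℛ k y))
  simp only [map_sum, TensorProduct.rid_tmul, one_smul] at h6
  rw [h6]

theorem sum_antipode_antipode_mul (w : H) :
    ∑ i ∈ (ℛ k w).index, antipode k (antipode k ((ℛ k w).right i)) * antipode k ((ℛ k w).left i) =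
      (counit w : k) • (1 : H) := by
  simp only [← antipode_mul_antidistrib, ← map_sum, sum_mul_antipode_eq_smul, map_smul,
    antipode_one]

theorem sum_hitR_mul [FiniteDimensional k H] (p : H →ₗ[k] k) (w x : H) :
    ∑ j, hitR (p ∘ₗ LinearMap.mulLeft k (antipode k (Module.finBasis k H j)))
      (antipode k (antipode k (hitR ((Module.finBasis k H).coord j) w)) * x) =
    antipode k (antipode k w) * hitR p x := by
  have hS2 : ∀ w : H, (comul (antipode k (antipode k w)) : H ⊗[k] H) =
      ∑ i ∈ (ℛ k w).index, antipode k (antipode k ((ℛ k w).left i)) ⊗ₜ[k]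
        antipode k (antipode k ((ℛ k w).right i)) := by
    intro w
    rw [comul_antipode, comul_antipode, ← (ℛ k w).eq]
    simp
  have hR : ∀ (q : H →ₗ[k] k) (w x : H), hitR q (antipode k (antipode k w) * x) =
      ∑ i ∈ (ℛ k w).index, ∑ l ∈ (ℛ k x).index,
        q (antipode k (antipode k ((ℛ k w).right i)) * (ℛ k x).right l) •
          (antipode k (antipode k ((ℛ k w).left i)) * (ℛ k x).left l) := by
    intro q w x
    rw [hitR, LinearMap.comp_apply, LinearMap.comp_apply, Bialgebra.comul_mul, hS2,
      ← (ℛ k x).eq]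
    simp only [Finset.sum_mul, Finset.mul_sum, map_sum, Algebra.TensorProduct.tmul_mul_tmul,
      LinearMap.lTensor_tmul, LinearEquiv.coe_coe, TensorProduct.rid_tmul]
    rw [Finset.sum_comm]
  have h1 : ∀ l, _ := fun l => coassoc_sum ((TensorProduct.rid k H).toLinearMap ∘ₗ
      TensorProduct.map (LinearMap.mulRight k ((ℛ k x).left l) ∘ₗ antipode k ∘ₗ antipode k)
      (p ∘ₗ LinearMap.mulRight k ((ℛ k x).right l) ∘ₗ LinearMap.mul' k H ∘ₗ
        (TensorProduct.comm k H H).toLinearMap ∘ₗ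
          TensorProduct.map (antipode k ∘ₗ antipode k) (antipode k))) w
  simp only [LinearMap.comp_apply, LinearEquiv.coe_coe, TensorProduct.map_tmul,
    TensorProduct.comm_tmul, TensorProduct.rid_tmul, LinearMap.mul'_apply,
    LinearMap.mulRight_apply] at h1
  have h2 : ∀ j, hitR (p ∘ₗ LinearMap.mulLeft k (antipode k (Module.finBasis k H j)))
      (antipode k (antipode k (hitR ((Module.finBasis k H).coord j) w)) * x) =
      ∑ i ∈ (ℛ k w).index, ∑ m ∈ (ℛ k ((ℛ k w).left i)).index, ∑ l ∈ (ℛ k x).index,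
        (Module.finBasis k H).coord j ((ℛ k w).right i) •
        (p ∘ₗ LinearMap.mulRight k
            (antipode k (antipode k ((ℛ k ((ℛ k w).left i)).right m)) * (ℛ k x).right l) ∘ₗ
            antipode k).smulRight
          (antipode k (antipode k ((ℛ k ((ℛ k w).left i)).left m)) * (ℛ k x).left l)
          (Module.finBasis k H j) := by
    intro j
    rw [hitR_eq (ℛ k w)]
    simp only [map_sum, map_smul, Finset.sum_mul, smul_mul_assoc, hR, Finset.smul_sum]
    rfl
  rw [Finset.sum_congr rfl fun j _ => h2 j, Finset.sum_comm]
  have h3 : ∀ i, ∑ j, ∑ m ∈ (ℛ k ((ℛ k w).left i)).index, ∑ l ∈ (ℛ k x).index,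
        (Module.finBasis k H).coord j ((ℛ k w).right i) •
        (p ∘ₗ LinearMap.mulRight k
            (antipode k (antipode k ((ℛ k ((ℛ k w).left i)).right m)) * (ℛ k x).right l) ∘ₗ
            antipode k).smulRight
          (antipode k (antipode k ((ℛ k ((ℛ k w).left i)).left m)) * (ℛ k x).left l)
          (Module.finBasis k H j) =
      ∑ l ∈ (ℛ k x).index, ∑ m ∈ (ℛ k ((ℛ k w).left i)).index,
        p (antipode k ((ℛ k w).right i) *
          antipode k (antipode k ((ℛ k ((ℛ k w).left i)).right m)) * (ℛ k x).right l) •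
        (antipode k (antipode k ((ℛ k ((ℛ k w).left i)).left m)) * (ℛ k x).left l) := by
    intro i
    rw [Finset.sum_comm, Finset.sum_comm (s := (ℛ k x).index)]
    refine Finset.sum_congr rfl fun m _ => ?_
    rw [Finset.sum_comm]
    refine Finset.sum_congr rfl fun l _ => ?_
    rw [sum_smul_right_basis, mul_assoc]
    rfl
  rw [Finset.sum_congr rfl fun i _ => h3 i, Finset.sum_comm, Finset.sum_congr rfl fun l _ => h1 l]
  have h4 : ∀ l i, ∑ m ∈ (ℛ k ((ℛ k w).right i)).index,
      p (antipode k ((ℛ k ((ℛ k w).right i)).right m) *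
        antipode k (antipode k ((ℛ k ((ℛ k w).right i)).left m)) * (ℛ k x).right l) •
        (antipode k (antipode k ((ℛ k w).left i)) * (ℛ k x).left l) =
      antipode k (antipode k ((counit ((ℛ k w).right i) : k) • (ℛ k w).left i)) *
        (p ((ℛ k x).right l) • (ℛ k x).left l) := by
    intro l i
    rw [← Finset.sum_smul, ← map_sum, ← Finset.sum_mul]
    simp only [← antipode_mul_antidistrib, ← map_sum, sum_antipode_mul_eq_smul, map_smul,
      antipode_one, smul_mul_assoc, one_mul, mul_smul_comm, smul_smul, smul_eq_mul]
    rw [mul_comm]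
  simp only [h4, ← Finset.mul_sum, ← Finset.sum_mul, ← map_sum]
  have h6 := congrArg (TensorProduct.rid k H) (sum_tmul_counit_eq (R := k) (ℛ k w))
  simp only [map_sum, TensorProduct.rid_tmul, one_smul] at h6
  rw [h6, ← hitR_eq]


theorem apply_hitL (f g : H →ₗ[k] k) (h : H) : f (hitL g h) = g (hitR f h) := by
  rw [hitL_eq (ℛ k h), hitR_eq (ℛ k h)]
  simp [mul_comm]

theorem counit_hitR (f : H →ₗ[k] k) (h : H) : (counit (hitR f h) : k) = f h := by
  rw [← apply_hitL]
  congr 1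
  have h6 := congrArg (TensorProduct.lid k H) (sum_counit_tmul_eq (R := k) (ℛ k h))
  simp only [map_sum, TensorProduct.lid_tmul, one_smul] at h6
  rw [hitL_eq (ℛ k h)]
  exact h6

theorem eq_of_forall_dual {V : Type*} [AddCommGroup V] [Module k V] {x y : V}
    (h : ∀ f : V →ₗ[k] k, f x = f y) : x = y := by
  rw [← sub_eq_zero, ← Module.forall_dual_apply_eq_zero_iff k]
  intro f
  rw [map_sub, h f, sub_self]

theorem exists_isRightCointegral_ne_zero (k H : Type u) [Field k] [Ring H] [HopfAlgebra k H]
    [FiniteDimensional k H] : ∃ lam : H →ₗ[k] k, IsRightCointegral lam ∧ lam ≠ 0 := by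
  let P : (H →ₗ[k] k) → H →ₗ[k] k := fun φ =>
    LinearMap.trace k H ∘ₗ LinearMap.lcomp k H (antipode k ∘ₗ antipode k ∘ₗ hitL φ) ∘ₗ
      (LinearMap.mul k H).flip
  let E : (H →ₗ[k] k) → H → H →ₗ[k] H := fun φ x =>
    LinearMap.mulRight k x ∘ₗ antipode k ∘ₗ antipode k ∘ₗ hitL φ
  have hPE : ∀ φ x, P φ x = LinearMap.trace k H (E φ x) := fun φ x => rfl
  have h1 : ∀ φ p x, P φ (hitR p x) = p 1 * P φ x := by
    intro φ p x
    rw [hPE, hPE]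
    have e1 : E φ (hitR p x) = ∑ j,
        hitR (p ∘ₗ LinearMap.mulLeft k (antipode k (Module.finBasis k H j))) ∘ₗ
          (E φ x ∘ₗ hitR ((Module.finBasis k H).coord j)) := by
      ext y
      simp only [LinearMap.sum_apply, LinearMap.comp_apply, E, LinearMap.mulRight_apply,
        hitL_hitR]
      exact (sum_hitR_mul p (hitL φ y) x).symm
    have e2 : p 1 • E φ x = ∑ j, (E φ x ∘ₗ hitR ((Module.finBasis k H).coord j)) ∘ₗ
        hitR (p ∘ₗ LinearMap.mulLeft k (antipode k (Module.finBasis k H j))) := by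
      ext y
      rw [LinearMap.smul_apply, ← map_smul, ← sum_hitR_hitR, map_sum]
      simp [LinearMap.sum_apply]
    rw [e1, ← smul_eq_mul, ← map_smul, e2, map_sum, map_sum]
    exact Finset.sum_congr rfl fun j _ => LinearMap.trace_comp_comm' _ _
  have h2 : ∀ φ, IsRightCointegral (P φ) := by
    intro φ x
    refine eq_of_forall_dual (k := k) fun p => ?_
    rw [apply_hitL, h1, map_smul, smul_eq_mul, mul_comm]
  have h3 : ∀ (φ : H →ₗ[k] k) x, ∑ j, P (φ ∘ₗ hitR ((Module.finBasis k H).coord j))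
      (antipode k (Module.finBasis k H j) * x) = φ x := by
    intro φ x
    have : ∑ j, E (φ ∘ₗ hitR ((Module.finBasis k H).coord j))
      (antipode k (Module.finBasis k H j) * x) = φ.smulRight x := by
      ext y
      simp only [LinearMap.sum_apply, E, LinearMap.comp_apply, LinearMap.mulRight_apply, hitL_hitL,
        LinearMap.smulRight_apply]
      have h4 : ∀ w : H, ∑ j, antipode k (antipode k (hitL ((Module.finBasis k H).coord j) w)) *
          (antipode k (Module.finBasis k H j) * x) = (counit w : k) • x := by
        intro w
        have h5 : ∀ j, antipode k (antipode k (hitL ((Module.finBasis k H).coord j) w)) *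
          (antipode k (Module.finBasis k H j) * x) = ∑ i ∈ (ℛ k w).index,
            (Module.finBasis k H).coord j ((ℛ k w).left i) •
            (LinearMap.mulLeft k (antipode k (antipode k ((ℛ k w).right i))) ∘ₗ
              LinearMap.mulRight k x ∘ₗ antipode k) (Module.finBasis k H j) := by
          intro j
          rw [hitL_eq (ℛ k w)]
          simp [Finset.sum_mul]
        rw [Finset.sum_congr rfl fun j _ => h5 j, Finset.sum_comm,
          Finset.sum_congr rfl fun i _ => sum_smul_right_basis _ _]
        simp only [LinearMap.comp_apply, LinearMap.mulLeft_apply, LinearMap.mulRight_apply,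
          ← mul_assoc]
        rw [← Finset.sum_mul, sum_antipode_antipode_mul, smul_mul_assoc, one_mul]
      rw [h4, apply_hitL]
      congr 1
      congr 1
      have h6 := congrArg (TensorProduct.rid k H) (sum_tmul_counit_eq (R := k) (ℛ k y))
      simp only [map_sum, TensorProduct.rid_tmul, one_smul] at h6
      rw [hitR_eq (ℛ k y)]
      exact h6
    simp only [hPE]
    rw [← map_sum, this, LinearMap.trace_smulRight]
  by_contra! hcon
  have h4 : ∀ φ, P φ = 0 := fun φ => hcon _ (h2 φ)
  have h5 := h3 counit 1
  simp [h4] at h5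

theorem IsRightCointegral.hitL_mulRight {lam : H →ₗ[k] k} (h : IsRightCointegral lam) (x y : H) :
    hitL (lam ∘ₗ LinearMap.mulRight k y) x = antipode k (hitL (lam ∘ₗ LinearMap.mulLeft k x) y) := by
  have h1 : ∀ z : H, lam (x * z) • (1 : H) = ∑ a ∈ (ℛ k x).index, ∑ b ∈ (ℛ k z).index,
      lam ((ℛ k x).left a * (ℛ k z).left b) • ((ℛ k x).right a * (ℛ k z).right b) := by
    intro z
    rw [← h, hitL, LinearMap.comp_apply, LinearMap.comp_apply, Bialgebra.comul_mul,
      ← (ℛ k z).eq, ← (ℛ k x).eq]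
    simp only [Finset.sum_mul, Finset.mul_sum, map_sum, Algebra.TensorProduct.tmul_mul_tmul,
      LinearMap.rTensor_tmul, LinearEquiv.coe_coe, TensorProduct.lid_tmul]
    rw [Finset.sum_comm]
  have h2 : ∀ a, _ := fun a => coassoc_sum ((TensorProduct.lid k H).toLinearMap ∘ₗ
    TensorProduct.map (lam ∘ₗ LinearMap.mulLeft k ((ℛ k x).left a))
      (LinearMap.mulLeft k ((ℛ k x).right a) ∘ₗ LinearMap.mul' k H ∘ₗ
        (antipode k).lTensor H)) y
  simp only [LinearMap.comp_apply, LinearEquiv.coe_coe, TensorProduct.map_tmul,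
    LinearMap.lTensor_tmul, TensorProduct.lid_tmul, LinearMap.mul'_apply,
    LinearMap.mulLeft_apply] at h2
  rw [hitL_eq (ℛ k y), map_sum]
  have h3 : ∀ i, antipode k ((lam ∘ₗ LinearMap.mulLeft k x) ((ℛ k y).left i) • (ℛ k y).right i) =
      ∑ a ∈ (ℛ k x).index, ∑ b ∈ (ℛ k ((ℛ k y).left i)).index,
      lam ((ℛ k x).left a * (ℛ k ((ℛ k y).left i)).left b) •
        ((ℛ k x).right a * ((ℛ k ((ℛ k y).left i)).right b * antipode k ((ℛ k y).right i))) := by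
    intro i
    rw [map_smul, LinearMap.comp_apply, LinearMap.mulLeft_apply,
      ← one_mul (antipode k ((ℛ k y).right i)), ← smul_mul_assoc, h1, Finset.sum_mul]
    simp only [Finset.sum_mul, smul_mul_assoc, mul_assoc, one_mul]
  rw [Finset.sum_congr rfl fun i _ => h3 i, Finset.sum_comm, Finset.sum_congr rfl fun a _ => h2 a,
    hitL_eq (ℛ k x)]
  refine Finset.sum_congr rfl fun a _ => ?_
  have h4 : ∀ i, ∑ j ∈ (ℛ k ((ℛ k y).right i)).index,
      lam ((ℛ k x).left a * (ℛ k y).left i) • ((ℛ k x).right a *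
        ((ℛ k ((ℛ k y).right i)).left j * antipode k ((ℛ k ((ℛ k y).right i)).right j))) =
      lam ((ℛ k x).left a * ((counit ((ℛ k y).right i) : k) • (ℛ k y).left i)) •
        (ℛ k x).right a := by
    intro i
    rw [← Finset.smul_sum, ← Finset.mul_sum, sum_mul_antipode_eq_smul, mul_smul_comm, mul_one,
      mul_smul_comm, map_smul, smul_smul, smul_eq_mul, mul_comm]
  rw [Finset.sum_congr rfl fun i _ => h4 i, ← Finset.sum_smul, ← map_sum, ← Finset.mul_sum]
  have h6 := congrArg (TensorProduct.rid k H) (sum_tmul_counit_eq (R := k) (ℛ k y))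
  simp only [map_sum, TensorProduct.rid_tmul, one_smul] at h6
  rw [h6]
  rfl

theorem sum_basis_mul_antipode [FiniteDimensional k H] (n : H) :
    ∑ j, hitR ((Module.finBasis k H).coord j) n * antipode k (Module.finBasis k H j) =
      (counit n : k) • (1 : H) := by
  have h5 : ∀ j, hitR ((Module.finBasis k H).coord j) n * antipode k (Module.finBasis k H j) =
      ∑ i ∈ (ℛ k n).index, (Module.finBasis k H).coord j ((ℛ k n).right i) •
        (LinearMap.mulLeft k ((ℛ k n).left i) ∘ₗ antipode k) (Module.finBasis k H j) := by
    intro j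
    rw [hitR_eq (ℛ k n)]
    simp [Finset.sum_mul]
  rw [Finset.sum_congr rfl fun j _ => h5 j, Finset.sum_comm,
    Finset.sum_congr rfl fun i _ => sum_smul_right_basis _ _]
  exact sum_mul_antipode_eq_smul _

theorem sum_basis_mul_antipode' [FiniteDimensional k H] (n : H) :
    ∑ j, Module.finBasis k H j * antipode k (hitL ((Module.finBasis k H).coord j) n) =
      (counit n : k) • (1 : H) := by
  have h5 : ∀ j, Module.finBasis k H j * antipode k (hitL ((Module.finBasis k H).coord j) n) =
      ∑ i ∈ (ℛ k n).index, (Module.finBasis k H).coord j ((ℛ k n).left i) •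
        (LinearMap.mulRight k (antipode k ((ℛ k n).right i))) (Module.finBasis k H j) := by
    intro j
    rw [hitL_eq (ℛ k n)]
    simp [Finset.mul_sum]
  rw [Finset.sum_congr rfl fun j _ => h5 j, Finset.sum_comm,
    Finset.sum_congr rfl fun i _ => sum_smul_right_basis _ _]
  exact sum_mul_antipode_eq_smul _

theorem IsRightCointegral.eq_zero [FiniteDimensional k H] {lam : H →ₗ[k] k}
    (h : IsRightCointegral lam) (h0 : lam ≠ 0) {x : H} (hx : ∀ y, lam (x * y) = 0) : x = 0 := by
  have key : ∀ n : H, (∀ y, lam (n * y) = 0) → ∀ (f : H →ₗ[k] k) y, lam (hitR f n * y) = 0 := by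
    intro n hn f y
    have e := h.hitL_mulRight n y
    have e0 : lam ∘ₗ LinearMap.mulLeft k n = 0 := LinearMap.ext hn
    rw [e0] at e
    have e1 := congrArg f e
    rw [apply_hitL] at e1
    refine (e1.trans ?_ : _)
    simp [hitL]
  have hε : ∀ n : H, (∀ y, lam (n * y) = 0) → (counit n : k) = 0 := by
    intro n hn
    by_contra hc
    apply h0
    ext z
    have e := congrArg (fun t => lam (t * z)) (sum_basis_mul_antipode (k := k) n)
    simp only [Finset.sum_mul, map_sum, mul_assoc, key n hn, Finset.sum_const_zero,
      smul_mul_assoc, one_mul, map_smul, smul_eq_mul] at e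
    simpa [hc] using e.symm
  refine eq_of_forall_dual (k := k) fun f => ?_
  rw [← counit_hitR, hε _ (key x hx f), map_zero]

theorem IsRightCointegral.exists_left [FiniteDimensional k H] {lam : H →ₗ[k] k}
    (h : IsRightCointegral lam) (h0 : lam ≠ 0) (f : H →ₗ[k] k) :
    ∃ x, lam ∘ₗ LinearMap.mulLeft k x = f := by
  let B : H →ₗ[k] Module.Dual k H := (LinearMap.mul k H).compr₂ lam
  have hB : Function.Injective B := by
    rw [← LinearMap.ker_eq_bot, LinearMap.ker_eq_bot']
    intro x hx
    exact h.eq_zero h0 fun y => LinearMap.congr_fun hx y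
  obtain ⟨x, hx⟩ := (LinearMap.injective_iff_surjective_of_finrank_eq_finrank
    (Subspace.dual_finrank_eq (K := k) (V := H)).symm).1 hB f
  exact ⟨x, hx⟩

theorem IsRightCointegral.eq_zero' [FiniteDimensional k H] {lam : H →ₗ[k] k}
    (h : IsRightCointegral lam) (h0 : lam ≠ 0) {y : H} (hy : ∀ x, lam (x * y) = 0) : y = 0 := by
  refine eq_of_forall_dual (k := k) fun f => ?_
  obtain ⟨x, rfl⟩ := h.exists_left h0 f
  simpa using hy x

theorem IsRightCointegral.exists_right [FiniteDimensional k H] {lam : H →ₗ[k] k}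
    (h : IsRightCointegral lam) (h0 : lam ≠ 0) (f : H →ₗ[k] k) :
    ∃ y, lam ∘ₗ LinearMap.mulRight k y = f := by
  let B : H →ₗ[k] Module.Dual k H := (LinearMap.mul k H).flip.compr₂ lam
  have hB : Function.Injective B := by
    rw [← LinearMap.ker_eq_bot, LinearMap.ker_eq_bot']
    intro x hx
    exact h.eq_zero' h0 fun y => LinearMap.congr_fun hx y
  obtain ⟨x, hx⟩ := (LinearMap.injective_iff_surjective_of_finrank_eq_finrank
    (Subspace.dual_finrank_eq (K := k) (V := H)).symm).1 hB f
  exact ⟨x, hx⟩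

theorem IsRightCointegral.unique [FiniteDimensional k H] {lam μ : H →ₗ[k] k}
    (h : IsRightCointegral lam) (h0 : lam ≠ 0) (hμ : IsRightCointegral μ) :
    ∃ c : k, μ = c • lam := by
  obtain ⟨a, rfl⟩ := h.exists_right h0 μ
  have h1 : ∀ f : H →ₗ[k] k, antipode k (hitL f a) = f a • (1 : H) := by
    intro f
    obtain ⟨x, rfl⟩ := h.exists_left h0 f
    rw [← h.hitL_mulRight, hμ]
    rfl
  have h2 : a = (counit a : k) • (1 : H) := by
    rw [← sum_basis_mul_antipode' (k := k) a]
    simp only [h1, mul_smul_comm, mul_one]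
    exact (sum_smul_right_basis (LinearMap.id : H →ₗ[k] H) a).symm
  refine ⟨counit a, LinearMap.ext fun x => ?_⟩
  simp only [LinearMap.comp_apply, LinearMap.mulRight_apply, LinearMap.smul_apply]
  rw [h2]
  simp

theorem exists_ne_zero_apply {lam : H →ₗ[k] k} (h0 : lam ≠ 0) : ∃ x, lam x = 1 := by
  obtain ⟨x, hx⟩ : ∃ x, lam x ≠ 0 := by
    by_contra! hc
    exact h0 (LinearMap.ext hc)
  exact ⟨(lam x)⁻¹ • x, by simp [hx]⟩

variable (k H) in
/-- There is a unique group-like element `g` with `h₍₁₎ λ(h₍₂₎) = λ(h) g` for all right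
cointegrals `λ` on `H` and all `h`. -/
theorem existsUnique_distinguishedGrouplike [FiniteDimensional k H] :
    ∃! g : GroupLike k H, ∀ lam : H →ₗ[k] k, IsRightCointegral lam →
      ∀ h, hitR lam h = lam h • (g : H) := by
  obtain ⟨lam, hlam, h0⟩ := exists_isRightCointegral_ne_zero k H
  obtain ⟨x, hx⟩ := exists_ne_zero_apply h0
  have h1 : ∀ h, hitR lam h = lam h • hitR lam x := by
    intro h
    refine eq_of_forall_dual (k := k) fun p => ?_
    have hp : IsRightCointegral (lam ∘ₗ hitL p) := by
      intro y
      have : lam ∘ₗ hitL p = p ∘ₗ hitR lam := LinearMap.ext fun z => apply_hitL _ _ _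
      rw [this, hitL_hitL, hlam, apply_hitL]
      rfl
    obtain ⟨c, hc⟩ := hlam.unique h0 hp
    have hc' : ∀ y, p (hitR lam y) = c * lam y := fun y => by
      rw [← apply_hitL]
      exact LinearMap.congr_fun hc y
    rw [map_smul, hc', hc', hx, smul_eq_mul, mul_one, mul_comm]
  have h2 : ∀ f : H →ₗ[k] k, hitL f (hitR lam x) = f (hitR lam x) • hitR lam x := by
    intro f
    rw [hitL_hitR, h1, apply_hitL]
  have h3 : IsGroupLikeElem k (hitR lam x) := by
    refine ⟨?_, ?_⟩
    · rw [counit_hitR, hx]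
    · have : ∀ t : H ⊗[k] H, t = ∑ j, Module.finBasis k H j ⊗ₜ[k]
          TensorProduct.lid k H (((Module.finBasis k H).coord j).rTensor H t) := by
        intro t
        induction t with
        | zero => simp
        | add x y hx hy =>
          conv_lhs => rw [hx, hy]
          simp only [map_add, TensorProduct.tmul_add, Finset.sum_add_distrib]
        | tmul x y =>
          simp only [LinearMap.rTensor_tmul, TensorProduct.lid_tmul, TensorProduct.tmul_smul]
          exact (sum_smul_right_basis ((TensorProduct.mk k H H).flip y) x).symm
      rw [this (comul _)]
      refine (Finset.sum_congr rfl fun j _ => congrArg (fun t => Module.finBasis k H j ⊗ₜ[k] t)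
        (h2 ((Module.finBasis k H).coord j))).trans ?_
      simp only [TensorProduct.tmul_smul]
      exact sum_smul_right_basis ((TensorProduct.mk k H H).flip (hitR lam x)) (hitR lam x)
  refine ⟨⟨hitR lam x, h3⟩, fun μ hμ h => ?_, fun g hg => ?_⟩
  · obtain ⟨c, rfl⟩ := hlam.unique h0 hμ
    have := h1 h
    simp only [hitR, LinearMap.lTensor_smul, LinearMap.comp_smul, LinearMap.smul_comp,
      LinearMap.smul_apply] at this ⊢
    rw [this, smul_assoc]
  · have := hg lam hlam x
    rw [hx, one_smul] at this
    exact GroupLike.ext this.symm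

variable (k H) in
/-- There is a unique algebra map `α : H → k` with `Λ h = α(h) Λ` for all left integrals `Λ` in
`H` and all `h`. -/
theorem existsUnique_modularFunction [FiniteDimensional k H] :
    ∃! α : H →ₐ[k] k, ∀ Lam : H, IsLeftIntegral k Lam → ∀ h, Lam * h = α h • Lam := by
  obtain ⟨lam, hlam, h0⟩ := exists_isRightCointegral_ne_zero k H
  obtain ⟨Lam, hL⟩ := hlam.exists_right h0 counit
  replace hL : ∀ x, lam (x * Lam) = counit x := fun x => LinearMap.congr_fun hL x
  have hext : ∀ a b : H, (∀ x, lam (x * a) = lam (x * b)) → a = b := by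
    intro a b hab
    rw [← sub_eq_zero]
    refine hlam.eq_zero' h0 fun x => ?_
    rw [mul_sub, map_sub, hab, sub_self]
  have hint : IsLeftIntegral k Lam := fun h => hext _ _ fun x => by
    rw [← mul_assoc, hL, mul_smul_comm, map_smul, hL, Bialgebra.counit_mul, smul_eq_mul, mul_comm]
  have huniq : ∀ L : H, IsLeftIntegral k L → L = lam L • Lam := fun L h => hext _ _ fun x => by
    rw [h x, mul_smul_comm, map_smul, map_smul, hL, smul_eq_mul, smul_eq_mul, mul_comm]
  have hL1 : lam Lam = 1 := by
    have := hL 1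
    rwa [one_mul, Bialgebra.counit_one] at this
  have hα : ∀ h, Lam * h = lam (Lam * h) • Lam := fun h => huniq _ fun x => by
    rw [← mul_assoc, hint, smul_mul_assoc]
  let α : H →ₐ[k] k := AlgHom.ofLinearMap (lam ∘ₗ LinearMap.mulLeft k Lam)
    (by simpa using hL1) (fun x y => by
      simp only [LinearMap.comp_apply, LinearMap.mulLeft_apply]
      rw [← mul_assoc, hα x, smul_mul_assoc, map_smul, map_smul, hL1, smul_eq_mul, smul_eq_mul,
        mul_one])
  refine ⟨α, fun L h x => ?_, fun β hβ => ?_⟩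
  · rw [huniq L h, smul_mul_assoc, hα x, smul_comm]
    rfl
  · ext h
    have := congrArg lam (hβ Lam hint h)
    rw [map_smul, hL1, smul_eq_mul, mul_one] at this
    exact this.symm
end
end HopfIntegral

section

variable (k H : Type u) [Field k] [Ring H] [HopfAlgebra k H] [FiniteDimensional k H]

/-- The distinguished group-like element `g_H` of a finite-dimensional Hopf algebra `H`: the
unique group-like element with `h₍₁₎ λ(h₍₂₎) = λ(h) g_H` for all right cointegrals `λ` on `H`. -/
def distinguishedGrouplike : GroupLike k H :=
  (HopfIntegral.existsUnique_distinguishedGrouplike k H).choose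

theorem distinguishedGrouplike_spec (lam : H →ₗ[k] k) (h : HopfIntegral.IsRightCointegral lam)
    (x : H) : HopfIntegral.hitR lam x = lam x • (distinguishedGrouplike k H : H) :=
  (HopfIntegral.existsUnique_distinguishedGrouplike k H).choose_spec.1 lam h x

/-- The left modular function `α_H` of a finite-dimensional Hopf algebra `H`: the unique algebra
map `H → k` with `Λ h = α_H(h) Λ` for all left integrals `Λ` in `H`. -/
def modularFunction : H →ₐ[k] k :=
  (HopfIntegral.existsUnique_modularFunction k H).choose

theorem modularFunction_spec (Lam : H) (h : HopfIntegral.IsLeftIntegral k Lam) (x : H) :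
    Lam * x = modularFunction k H x • Lam :=
  (HopfIntegral.existsUnique_modularFunction k H).choose_spec.1 Lam h x

/-- The convolution inverse `ᾱ_H = α_H ∘ S` of the left modular function. -/
def modularFunctionInv : H →ₗ[k] k :=
  (modularFunction k H).toLinearMap ∘ₗ HopfAlgebra.antipode k

end

section Algebra

variable {k H A : Type u} [Field k] [Ring H] [HopfAlgebra k H] [Ring A] [Algebra k A]

/-- `LeftComodule.hit f m = m ↼ f = f(m₍₋₁₎) m₍₀₎`. -/
def LeftComodule.hit {M : Type u} [AddCommGroup M] [Module k M] [LeftComodule k H M]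
    (f : H →ₗ[k] k) : M →ₗ[k] M :=
  (TensorProduct.lid k M).toLinearMap ∘ₗ f.rTensor M ∘ₗ LeftComodule.coact k H

/-- A `g`-cointegral on a left `H`-comodule algebra `A`: a linear form `λ` on `A` with
`a₍₋₁₎ λ(a₍₀₎) = λ(a) g`. -/
def IsCointegral [LeftComoduleAlgebra k H A] (g : GroupLike k H) (lam : A →ₗ[k] k) : Prop :=
  ∀ a, TensorProduct.rid k H (lam.lTensor H (LeftComodule.coact k H a)) = lam a • (g : H)

/-- The bilinear form `(a, b) ↦ λ(a b)`. -/
def traceForm (lam : A →ₗ[k] k) : LinearMap.BilinForm k A := (LinearMap.mul k A).compr₂ lam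

/-- `λ` is a Frobenius trace on `A`: the bilinear form `(a, b) ↦ λ(a b)` is non-degenerate. -/
def IsFrobeniusTrace (lam : A →ₗ[k] k) : Prop := (traceForm lam).Nondegenerate

/-- The Nakayama automorphism `ν` of `A` with respect to a Frobenius trace `λ`, determined by
`λ(b a) = λ(ν(a) b)`. -/
def nakayamaAut [FiniteDimensional k A] (lam : A →ₗ[k] k) (h : IsFrobeniusTrace lam) :
    A →ₗ[k] A :=
  (LinearMap.BilinForm.toDual (traceForm lam) h).symm.toLinearMap ∘ₗ (traceForm lam).flip

theorem nakayamaAut_spec [FiniteDimensional k A] (lam : A →ₗ[k] k) (h : IsFrobeniusTrace lam)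
    (a b : A) : lam (b * a) = lam (nakayamaAut lam h a * b) := by
  have := LinearMap.BilinForm.apply_toDual_symm_apply (hB := h) ((traceForm lam).flip a) b
  exact this.symm

end Algebra

/-- The category of relative Hopf bimodules over `A`, `A` is unimodular: its Nakayama functor
fixes the unit object `A` up to isomorphism. -/
def IsUnimodular (k H A : Type u) [Field k] [Ring H] [HopfAlgebra k H] [Ring A] [Algebra k A]
    [LeftComoduleAlgebra k H A] [FiniteDimensional k A] : Prop :=
  RelHopfBimod.IsNakayama (RelHopfBimod.unitObj k H A) (RelHopfBimod.unitObj k H A)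

end

/-! The proof computes Nak(A) explicitly. Let λ_H be a nonzero right cointegral on H, and let e_i,
e^i be bases of A with λ_A(e^i e_j) = δ_ij. For x in a relative Hopf bimodule X, the element ∑ e_i
λ_H(x₍₋₁₎ g_A) x₍₀₎ e^i is central and coinvariant (`isInvariant_average`), so it is the image of 1
under a morphism A ⟶ X. Hence a functional ξ on Hom(A, X) and x ∈ X determine ⟨ξ, x⟩ ∈ A by λ_A(b⟨ξ,
x⟩) = ξ(average of bx), naturally in X: a cowedge whose vertex has underlying space A.

The structure on the vertex is forced by how averaging treats the actions and the coaction. Left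
multiplication is the regular one. Moving an element across the average uses the Nakayama
automorphisms of both λ_A and λ_H, the latter bringing in α_H, and twists the right action by the
inverse of a ↦ ν_A²(a ↼ ᾱ_H) (`average_ract_twist`, `nakPair_ract_twist`). The coaction becomes a ↦
a₍₋₁₎c ⊗ a₍₀₎ with c = g_A⁻¹ g_H g_A⁻¹ (`average_hit`, `nakPair_hit`).

Universality rests on `exists_generator`: P = A ⊗ A ⊗ H has an element p that can be sent to any
element of any X, and b ↦ average of bp identifies A with Hom(A, P). In any cowedge every η ⊗ x can
therefore be rewritten as ξ ⊗ p, with ξ determined by ⟨η, x⟩ (`nonempty_isColimit_nakCowedge`).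

Finally, a left A-linear isomorphism from A to the twisted A is right multiplication by a unit v.
Right linearity and colinearity are the two conditions on v (`nonempty_iso_nakObj_iff`), and c⁻¹ =
g_H⁻¹ g_A² because g_H commutes with grouplikes. -/

set_option linter.unusedSectionVars false

/-! ### The action of H^* on comodules, and Sweedler sums over a basis of H -/

noncomputable section

namespace LeftComodule
open Coalgebra HopfAlgebra HopfIntegral

variable {k H : Type u} [Field k] [Ring H] [HopfAlgebra k H]
  {M : Type u} [AddCommGroup M] [Module k M] [LeftComodule k H M]

/-- The action `hit` as a linear map of the functional. -/
def hitHom (m : M) : (H →ₗ[k] k) →ₗ[k] M where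
  toFun f := hit f m
  map_add' f g := by simp [hit, LinearMap.rTensor_add]
  map_smul' c f := by simp [hit, LinearMap.rTensor_smul]

theorem hitHom_apply (m : M) (f : H →ₗ[k] k) : hitHom m f = hit f m := rfl

theorem hit_smul (c : k) (f : H →ₗ[k] k) (m : M) : hit (c • f) m = c • hit f m :=
  (hitHom m).map_smul c f

theorem hit_counit (m : M) : hit (counit : H →ₗ[k] k) m = m := by
  simp [hit, counit_coact]

theorem hit_hit (f g : H →ₗ[k] k) (m : M) : hit g (hit f m) = hit (g ∘ₗ hitL f) m := by
  have h := congrArg ((TensorProduct.lid k M).toLinearMap ∘ₗ TensorProduct.map f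
    ((TensorProduct.lid k M).toLinearMap ∘ₗ g.rTensor M)) (coassoc (k := k) (H := H) m)
  refine Eq.trans ?_ (h.symm.trans ?_)
  · simp only [hit, LinearMap.comp_apply, LinearEquiv.coe_coe]
    generalize coact k H m = t
    induction t with
    | zero => simp
    | add x y hx hy => simp only [map_add, hx, hy]
    | tmul a y => simp
  · simp only [hit, LinearMap.comp_apply, LinearEquiv.coe_coe]
    generalize coact k H m = t
    induction t with
    | zero => simp
    | add x y hx hy => simp only [map_add, hx, hy]
    | tmul a y =>
      simp only [LinearMap.rTensor_tmul, LinearMap.comp_apply, hitL, LinearEquiv.coe_coe]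
      generalize (comul a : H ⊗[k] H) = t
      induction t with
      | zero => simp
      | add x y hx hy => simp only [map_add, TensorProduct.add_tmul, hx, hy]
      | tmul a b => simp [smul_smul, mul_comm]

variable [FiniteDimensional k H]

/-- Sweedler notation is replaced throughout by sums over a fixed basis of H: the pair (m₍₋₁₎, m₍₀₎)
becomes the basis vectors paired with the actions of the coordinate functionals. This expansion is
the dictionary. -/
theorem tensor_eq_sum {V : Type*} [AddCommGroup V] [Module k V] (t : H ⊗[k] V) :
    t = ∑ j, Module.finBasis k H j ⊗ₜ[k]
      TensorProduct.lid k V (((Module.finBasis k H).coord j).rTensor V t) := by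
  induction t with
  | zero => simp
  | add x y hx hy =>
    conv_lhs => rw [hx, hy]
    simp only [map_add, TensorProduct.tmul_add, Finset.sum_add_distrib]
  | tmul x y =>
    simp only [LinearMap.rTensor_tmul, TensorProduct.lid_tmul, TensorProduct.tmul_smul]
    exact (sum_smul_right_basis ((TensorProduct.mk k H V).flip y) x).symm

theorem coact_eq_sum (m : M) : coact k H m =
    ∑ j, Module.finBasis k H j ⊗ₜ[k] hit ((Module.finBasis k H).coord j) m :=
  tensor_eq_sum _

/-- Elements of `H ⊗ V` are separated by the functionals on `H`. -/
theorem tensor_ext {V : Type*} [AddCommGroup V] [Module k V] {s t : H ⊗[k] V}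
    (h : ∀ f : H →ₗ[k] k, TensorProduct.lid k V (f.rTensor V s) =
      TensorProduct.lid k V (f.rTensor V t)) : s = t := by
  rw [tensor_eq_sum s, tensor_eq_sum t]
  simp only [h]

variable {V : Type*} [AddCommGroup V] [Module k V]

theorem sum_hit (E : H →ₗ[k] M →ₗ[k] V) (m : M) :
    ∑ j, E (Module.finBasis k H j) (hit ((Module.finBasis k H).coord j) m) =
      TensorProduct.lift E (coact k H m) := by
  rw [coact_eq_sum, map_sum]
  simp

theorem hit_eq_sum (f : H →ₗ[k] k) (m : M) :
    hit f m = ∑ j, f (Module.finBasis k H j) • hit ((Module.finBasis k H).coord j) m := by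
  conv_lhs => rw [hit, LinearMap.comp_apply, LinearMap.comp_apply, coact_eq_sum]
  simp

/-- The canonical element of H ⊗ H^* is unchanged when φ on one leg is traded for its transpose on
the other. Used whenever a map of H has to be moved between m₍₋₁₎ and the functional acting on m. -/
theorem sum_hit_comp (E : H →ₗ[k] M →ₗ[k] V) (φ : H →ₗ[k] H) (m : M) :
    ∑ j, E (Module.finBasis k H j) (hit ((Module.finBasis k H).coord j ∘ₗ φ) m) =
      ∑ j, E (φ (Module.finBasis k H j)) (hit ((Module.finBasis k H).coord j) m) := by
  simp only [fun j => hit_eq_sum ((Module.finBasis k H).coord j ∘ₗ φ) m, map_sum, map_smul]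
  rw [Finset.sum_comm]
  refine Finset.sum_congr rfl fun l _ => ?_
  exact sum_smul_right_basis (E.flip (hit ((Module.finBasis k H).coord l) m)) _

/-- Sum form of S(m₍₋₂₎) m₍₋₁₎ ⊗ m₍₀₎ = 1 ⊗ m: coassociativity merges the two actions, then the
antipode axiom applies. -/
theorem sum_hit_antipode_mul (Q : H →ₗ[k] M →ₗ[k] V) (m : M) :
    ∑ j, ∑ l, Q (antipode k (Module.finBasis k H j) * Module.finBasis k H l)
      (hit ((Module.finBasis k H).coord l) (hit ((Module.finBasis k H).coord j) m)) = Q 1 m := by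
  have h1 : ∀ j, ∑ l, Q (antipode k (Module.finBasis k H j) * Module.finBasis k H l)
      (hit ((Module.finBasis k H).coord l) (hit ((Module.finBasis k H).coord j) m)) =
      ∑ l, Q (antipode k (Module.finBasis k H j) *
        hitL ((Module.finBasis k H).coord j) (Module.finBasis k H l))
        (hit ((Module.finBasis k H).coord l) m) := fun j => by
    simp only [hit_hit]
    exact sum_hit_comp (Q ∘ₗ LinearMap.mulLeft k (antipode k (Module.finBasis k H j)))
      (hitL ((Module.finBasis k H).coord j)) m
  rw [Finset.sum_congr rfl fun j _ => h1 j, Finset.sum_comm]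
  have h2 : ∀ z : H, ∑ j, antipode k (Module.finBasis k H j) *
      hitL ((Module.finBasis k H).coord j) z = (counit z : k) • (1 : H) := by
    intro z
    have h5 : ∀ j, antipode k (Module.finBasis k H j) * hitL ((Module.finBasis k H).coord j) z =
        ∑ i ∈ (ℛ k z).index, (Module.finBasis k H).coord j ((ℛ k z).left i) •
          (LinearMap.mulRight k ((ℛ k z).right i) ∘ₗ antipode k) (Module.finBasis k H j) := by
      intro j
      rw [hitL_eq (ℛ k z)]
      simp [Finset.mul_sum]
    rw [Finset.sum_congr rfl fun j _ => h5 j, Finset.sum_comm,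
      Finset.sum_congr rfl fun i _ => sum_smul_right_basis _ _]
    exact sum_antipode_mul_eq_smul _
  simp only [← LinearMap.sum_apply, ← map_sum, h2]
  simp only [map_smul, LinearMap.smul_apply]
  conv_rhs => rw [← hit_counit (k := k) (H := H) m, hit_eq_sum, map_sum]
  simp only [map_smul]

theorem sum_hit_mul_antipode (Q : H →ₗ[k] M →ₗ[k] V) (m : M) :
    ∑ j, ∑ l, Q (Module.finBasis k H j * antipode k (Module.finBasis k H l))
      (hit ((Module.finBasis k H).coord l) (hit ((Module.finBasis k H).coord j) m)) = Q 1 m := by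
  have h1 : ∀ j, ∑ l, Q (Module.finBasis k H j * antipode k (Module.finBasis k H l))
      (hit ((Module.finBasis k H).coord l) (hit ((Module.finBasis k H).coord j) m)) =
      ∑ l, Q (Module.finBasis k H j * antipode k
        (hitL ((Module.finBasis k H).coord j) (Module.finBasis k H l)))
        (hit ((Module.finBasis k H).coord l) m) := fun j => by
    simp only [hit_hit]
    exact sum_hit_comp (Q ∘ₗ LinearMap.mulLeft k (Module.finBasis k H j) ∘ₗ antipode k)
      (hitL ((Module.finBasis k H).coord j)) m
  rw [Finset.sum_congr rfl fun j _ => h1 j, Finset.sum_comm]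
  simp only [← LinearMap.sum_apply, ← map_sum, sum_basis_mul_antipode']
  simp only [map_smul, LinearMap.smul_apply]
  conv_rhs => rw [← hit_counit (k := k) (H := H) m, hit_eq_sum, map_sum]
  simp only [map_smul]

end LeftComodule
end

/-! ### Compatibility of the H^*-action with the bimodule actions -/

noncomputable section

namespace RelHopfBimod
open Coalgebra HopfAlgebra HopfIntegral LeftComodule

variable {k H A B : Type u} [Field k] [Ring H] [HopfAlgebra k H] [FiniteDimensional k H]
  [Ring A] [Algebra k A] [LeftComoduleAlgebra k H A]
  [Ring B] [Algebra k B] [LeftComoduleAlgebra k H B]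

local notation "𝐛" => Module.finBasis k H
local notation "𝐜" => Module.Basis.coord (Module.finBasis k H)

section
variable {V : Type*} [AddCommGroup V] [Module k V]

theorem sum_hit_lact (X : RelHopfBimod k H A B) (E : H →ₗ[k] X.carrier →ₗ[k] V)
    (a : A) (m : X.carrier) :
    ∑ l, E (𝐛 l) (hit (𝐜 l) (X.lact a m)) =
      ∑ i, ∑ j, E (𝐛 i * 𝐛 j) (X.lact (hit (𝐜 i) a) (hit (𝐜 j) m)) := by
  rw [sum_hit, X.coact_lact, coact_eq_sum a, coact_eq_sum m]
  simp only [map_sum, LinearMap.sum_apply, TensorProduct.map₂_apply_tmul, TensorProduct.map_tmul,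
    TensorProduct.lift.tmul, LinearMap.mul_apply']
  rw [Finset.sum_comm]

theorem sum_hit_ract (X : RelHopfBimod k H A B) (E : H →ₗ[k] X.carrier →ₗ[k] V)
    (a : B) (m : X.carrier) :
    ∑ l, E (𝐛 l) (hit (𝐜 l) (X.ract a m)) =
      ∑ i, ∑ j, E (𝐛 i * 𝐛 j) (X.ract (hit (𝐜 j) a) (hit (𝐜 i) m)) := by
  rw [sum_hit, X.coact_ract, coact_eq_sum a, coact_eq_sum m]
  simp only [map_sum, LinearMap.sum_apply, TensorProduct.map₂_apply_tmul, TensorProduct.map_tmul,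
    TensorProduct.lift.tmul, LinearMap.mul_apply', LinearMap.flip_apply]

end

theorem hit_lact (X : RelHopfBimod k H A B) (f : H →ₗ[k] k) (a : A) (m : X.carrier) :
    hit f (X.lact a m) = ∑ i, X.lact (hit (𝐜 i) a) (hit (f ∘ₗ LinearMap.mulLeft k (𝐛 i)) m) := by
  rw [hit_eq_sum]
  refine (X.sum_hit_lact (LinearMap.lsmul k X.carrier ∘ₗ f) a m).trans ?_
  simp only [fun i => hit_eq_sum (f ∘ₗ LinearMap.mulLeft k (𝐛 i)) m, map_sum, map_smul]
  rfl

theorem hit_ract (X : RelHopfBimod k H A B) (f : H →ₗ[k] k) (a : B) (m : X.carrier) :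
    hit f (X.ract a m) = ∑ i, X.ract (hit (𝐜 i) a) (hit (f ∘ₗ LinearMap.mulRight k (𝐛 i)) m) := by
  rw [hit_eq_sum]
  refine (X.sum_hit_ract (LinearMap.lsmul k X.carrier ∘ₗ f) a m).trans ?_
  simp only [fun i => hit_eq_sum (f ∘ₗ LinearMap.mulRight k (𝐛 i)) m, map_sum, map_smul]
  rw [Finset.sum_comm]
  rfl

/-- Inserting S(a₍₋₂₎) a₍₋₁₎ = ε in front of m₍₋₁₎ lets a₍₋₁₎ m₍₋₁₎ be read as the coaction of the
product, leaving S(a₍₋₁₎) inside the functional. -/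
theorem lact_hit (X : RelHopfBimod k H A B) (f : H →ₗ[k] k) (a : A) (m : X.carrier) :
    X.lact a (hit f m) = ∑ i, hit (f ∘ₗ LinearMap.mulLeft k (antipode k (𝐛 i)))
      (X.lact (hit (𝐜 i) a) m) := by
  have h := sum_hit_antipode_mul (X.lact.flip ∘ₗ hitHom m ∘ₗ (LinearMap.mul k H).compr₂ f) a
  simp only [LinearMap.comp_apply, LinearMap.flip_apply, hitHom_apply] at h
  have e : ∀ x, (LinearMap.mul k H).compr₂ f x = f ∘ₗ LinearMap.mulLeft k x := fun x => rfl
  simp only [e, LinearMap.mulLeft_mul, LinearMap.mulLeft_one, LinearMap.comp_id] at h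
  simp only [hit_lact, LinearMap.comp_assoc, ← h]

end RelHopfBimod

/-! ### Cointegrals on A and adjoints for the Frobenius form -/

theorem LeftComodule.apply_hit_eq {k H M : Type u} [Field k] [Ring H] [HopfAlgebra k H]
    [AddCommGroup M] [Module k M] [LeftComodule k H M]
    (lam : M →ₗ[k] k) (f : H →ₗ[k] k) (m : M) :
    lam (LeftComodule.hit f m) =
      f (TensorProduct.rid k H (lam.lTensor H (LeftComodule.coact k H m))) := by
  simp only [LeftComodule.hit, LinearMap.comp_apply, LinearEquiv.coe_coe]
  generalize LeftComodule.coact k H m = t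
  induction t with
  | zero => simp
  | add x y hx hy => simp only [map_add, hx, hy]
  | tmul a y => simp [mul_comm]

theorem IsCointegral.apply_hit {k H A : Type u} [Field k] [Ring H] [HopfAlgebra k H]
    [Ring A] [Algebra k A] [LeftComoduleAlgebra k H A] {g : GroupLike k H} {lam : A →ₗ[k] k}
    (hlam : IsCointegral g lam) (f : H →ₗ[k] k) (a : A) :
    lam (LeftComodule.hit f a) = f g * lam a := by
  rw [LeftComodule.apply_hit_eq, hlam, map_smul, smul_eq_mul, mul_comm]

section
variable {k A : Type u} [Field k] [Ring A] [Algebra k A] {lam : A →ₗ[k] k}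

theorem IsFrobeniusTrace.ext_left (hnd : IsFrobeniusTrace lam) {x y : A}
    (h : ∀ b, lam (x * b) = lam (y * b)) : x = y := by
  rw [← sub_eq_zero]
  refine hnd.1 _ fun b => ?_
  change lam ((x - y) * b) = 0
  rw [sub_mul, map_sub, h, sub_self]

theorem IsFrobeniusTrace.ext_right (hnd : IsFrobeniusTrace lam) {x y : A}
    (h : ∀ b, lam (b * x) = lam (b * y)) : x = y := by
  rw [← sub_eq_zero]
  refine hnd.2 _ fun b => ?_
  change lam (b * (x - y)) = 0
  rw [mul_sub, map_sub, h, sub_self]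

end

namespace LeftComodule
open Coalgebra HopfAlgebra HopfIntegral

variable {k H A : Type u} [Field k] [Ring H] [HopfAlgebra k H] [FiniteDimensional k H]
  [Ring A] [Algebra k A] [FiniteDimensional k A] [LeftComoduleAlgebra k H A]

local notation "𝐛" => Module.finBasis k H
local notation "𝐜" => Module.Basis.coord (Module.finBasis k H)

theorem mul_hit (f : H →ₗ[k] k) (a b : A) :
    a * hit f b = ∑ i, hit (f ∘ₗ LinearMap.mulLeft k (antipode k (𝐛 i))) (hit (𝐜 i) a * b) :=
  (RelHopfBimod.unitObj k H A).lact_hit f a b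

variable {g : GroupLike k H} {lam : A →ₗ[k] k}

/-- The adjoint of b ↦ b ↼ f for the form λ(ab): after `mul_hit` the whole product is acted upon,
and the cointegral evaluates that functional at g, producing f(S(a₍₋₁₎) g). -/
theorem _root_.IsCointegral.apply_mul_hit (hlam : IsCointegral g lam) (f : H →ₗ[k] k) (a b : A) :
    lam (a * hit f b) = lam (hit (f ∘ₗ LinearMap.mulRight k (g : H) ∘ₗ antipode k) a * b) := by
  rw [mul_hit, hit_eq_sum (_ ∘ₗ _) a, Finset.sum_mul, map_sum, map_sum]
  refine Finset.sum_congr rfl fun i _ => ?_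
  rw [hlam.apply_hit, smul_mul_assoc, map_smul]
  rfl

/-- ν compares left and right adjoints, so taking the adjoint of ↼ f twice gives its conjugate by ν.
The resulting functional is h ↦ f(g⁻¹ S²(h) g). -/
theorem nakayamaAut_hit (hlam : IsCointegral g lam) (hnd : IsFrobeniusTrace lam)
    (f : H →ₗ[k] k) (a : A) :
    nakayamaAut lam hnd (hit f a) = hit (f ∘ₗ LinearMap.mulRight k (g : H) ∘ₗ antipode k ∘ₗ
      LinearMap.mulRight k (g : H) ∘ₗ antipode k) (nakayamaAut lam hnd a) := by
  refine hnd.ext_left fun b => ?_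
  rw [← nakayamaAut_spec, hlam.apply_mul_hit, nakayamaAut_spec lam hnd, hlam.apply_mul_hit]
  rfl

theorem nakayamaAut_injective (hnd : IsFrobeniusTrace lam) :
    Function.Injective (nakayamaAut lam hnd) := by
  intro x y h
  refine hnd.ext_right fun b => ?_
  rw [nakayamaAut_spec lam hnd x b, nakayamaAut_spec lam hnd y b, h]

end LeftComodule

/-! ### Characters, cointegrals and the Nakayama automorphism of H -/

namespace HopfIntegral
open Coalgebra HopfAlgebra LeftComodule

variable {k H : Type u} [Field k] [Ring H] [HopfAlgebra k H]

theorem hitL_counit (h : H) : hitL (counit : H →ₗ[k] k) h = h := by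
  simp [hitL]

theorem hitR_counit (h : H) : hitR (counit : H →ₗ[k] k) h = h := by
  simp [hitR]

theorem apply_hitL_comp_antipode (α : H →ₐ[k] k) (h : H) :
    α (hitL (α.toLinearMap ∘ₗ antipode k) h) = counit h := by
  rw [hitL_eq (ℛ k h), map_sum]
  simp only [map_smul, LinearMap.comp_apply, AlgHom.toLinearMap_apply, smul_eq_mul, ← map_mul]
  rw [← map_sum, sum_antipode_mul_eq_smul, map_smul, map_one, smul_eq_mul, mul_one]

/-- Since k is commutative, α ∘ S is again a character. Both α ∘ S² and α are convolution inverses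
of it, on opposite sides, hence equal. -/
theorem apply_antipode_antipode (α : H →ₐ[k] k) (h : H) :
    α (antipode k (antipode k h)) = α h := by
  set p : H →ₗ[k] k := α.toLinearMap ∘ₗ antipode k
  have hp : ∀ h, p (hitL (p ∘ₗ antipode k) h) = counit h := by
    intro h
    rw [hitL_eq (ℛ k h), map_sum]
    have : ∀ x y, p x * p y = p (x * y) := fun x y => by
      simp [p, antipode_mul_antidistrib, mul_comm]
    simp only [map_smul, LinearMap.comp_apply, smul_eq_mul, this]
    rw [← map_sum, sum_antipode_mul_eq_smul, map_smul]
    simp [p]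
  have h1 := apply_hitL_comp_antipode α (hitL (p ∘ₗ antipode k) h)
  rw [← hitL_hitL] at h1
  have h2 : (p ∘ₗ antipode k) ∘ₗ hitR p = counit :=
    LinearMap.ext fun z => (apply_hitL _ _ _).symm.trans (hp z)
  rw [h2, hitL_counit, apply_hitL, hitR_counit] at h1
  exact h1.symm

theorem hitL_mul_groupLike (α : H →ₐ[k] k) (h : H) (g : GroupLike k H) :
    hitL α.toLinearMap (h * g) = α g • (hitL α.toLinearMap h * g) := by
  rw [hitL_eq (ℛ k h), hitL, LinearMap.comp_apply, LinearMap.comp_apply, Bialgebra.comul_mul,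
    g.2.comul_eq_tmul_self, ← (ℛ k h).eq]
  simp [Finset.sum_mul, Finset.smul_sum, smul_smul, mul_comm]

/-- The cointegral identity at xg, with the grouplike factor then cancelled on the right. -/
theorem IsRightCointegral.hitL_mulRight_groupLike {lam : H →ₗ[k] k}
    (h : IsRightCointegral lam) (x : H)
    (g : GroupLike k H) :
    hitL (lam ∘ₗ LinearMap.mulRight k (g : H)) x = lam (x * g) • ((g⁻¹ : GroupLike k H) : H) := by
  have := congrArg (fun t => t * antipode k (g : H)) (h (x * g))
  rw [smul_mul_assoc, one_mul] at this
  refine Eq.trans ?_ this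
  rw [hitL_eq (ℛ k x), hitL, LinearMap.comp_apply, LinearMap.comp_apply, Bialgebra.comul_mul,
    g.2.comul_eq_tmul_self, ← (ℛ k x).eq]
  simp [Finset.sum_mul, mul_assoc]

variable [FiniteDimensional k H] {lam : H →ₗ[k] k}

/-- By finite dimension surjectivity suffices. Choosing y with λ(· y) = ε turns the exchange formula
`hitL_mulRight` into an explicit preimage of x. -/
theorem antipode_injective : Function.Injective (antipode k : H →ₗ[k] H) := by
  obtain ⟨lam, h, h0⟩ := exists_isRightCointegral_ne_zero k H
  rw [LinearMap.injective_iff_surjective]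
  intro x
  obtain ⟨y, hy⟩ := h.exists_right h0 counit
  refine ⟨hitL (lam ∘ₗ LinearMap.mulLeft k x) y, ?_⟩
  rw [← h.hitL_mulRight, hy, hitL_counit]

/-- The identity λ(S(x) y₍₁₎) y₍₂₎ = x₍₁₎ λ(S(x₍₂₎) y), which makes the maps out of the cofree
object colinear. After applying S, it is `hitL_mulRight` at S(x). -/
theorem IsRightCointegral.hitL_mulLeft_antipode (h : IsRightCointegral lam) (x y : H) :
    hitL (lam ∘ₗ LinearMap.mulLeft k (antipode k x)) y =
      hitR (lam ∘ₗ LinearMap.mulRight k y ∘ₗ antipode k) x := by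
  apply antipode_injective (k := k)
  rw [← h.hitL_mulRight, hitL, LinearMap.comp_apply, LinearMap.comp_apply, comul_antipode,
    hitR_eq (ℛ k x), ← (ℛ k x).eq]
  simp

theorem IsRightCointegral.hitR_mulRight (h : IsRightCointegral lam) (x : H) (g : GroupLike k H) :
    hitR (lam ∘ₗ LinearMap.mulRight k (g : H)) x =
      lam (x * g) • ((distinguishedGrouplike k H * g⁻¹ : GroupLike k H) : H) := by
  have := congrArg (fun t => t * antipode k (g : H)) (distinguishedGrouplike_spec k H lam h (x * g))
  rw [smul_mul_assoc] at this
  refine Eq.trans ?_ this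
  rw [hitR_eq (ℛ k x), hitR, LinearMap.comp_apply, LinearMap.comp_apply, Bialgebra.comul_mul,
    g.2.comul_eq_tmul_self, ← (ℛ k x).eq]
  simp [Finset.sum_mul, mul_assoc]

variable (k H) in
/-- A left integral and a right cointegral can be normalised against each other. -/
theorem exists_integral : ∃ (lam : H →ₗ[k] k) (Lam : H), IsRightCointegral lam ∧ lam ≠ 0 ∧
    IsLeftIntegral k Lam ∧ lam Lam = 1 ∧ ∀ x, lam (x * Lam) = counit x := by
  obtain ⟨lam, hlam, h0⟩ := exists_isRightCointegral_ne_zero k H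
  obtain ⟨Lam, hL⟩ := hlam.exists_right h0 counit
  replace hL : ∀ x, lam (x * Lam) = counit x := fun x => LinearMap.congr_fun hL x
  refine ⟨lam, Lam, hlam, h0, fun h => ?_, by simpa using hL 1, hL⟩
  rw [← sub_eq_zero]
  refine hlam.eq_zero' h0 fun x => ?_
  rw [mul_sub, map_sub, ← mul_assoc, hL, mul_smul_comm, map_smul, hL, Bialgebra.counit_mul,
    smul_eq_mul, mul_comm, sub_self]

/-- The Nakayama automorphism of a Hopf algebra: `λ(y u) = α(u₍₁₎) λ(S²(u₍₂₎) y)`. -/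
theorem IsRightCointegral.apply_mul (h : IsRightCointegral lam) (h0 : lam ≠ 0) {Lam : H}
    (hL : IsLeftIntegral k Lam) (h1 : lam Lam = 1) (y u : H) :
    lam (y * u) = lam (antipode k (antipode k
      (hitL (modularFunction k H).toLinearMap u)) * y) := by
  have e2 : ∀ u, hitL (lam ∘ₗ LinearMap.mulRight k u) Lam =
      antipode k (hitL (modularFunction k H).toLinearMap u) := by
    intro u
    have : lam ∘ₗ LinearMap.mulLeft k Lam = (modularFunction k H).toLinearMap :=
      LinearMap.ext fun z => by simp [modularFunction_spec k H Lam hL, h1]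
    rw [h.hitL_mulRight, this]
  -- This and the next claim say that Λ₍₁₎ ⊗ S(Λ₍₂₎) is the Casimir element of the form λ(xy):
  -- λ(xΛ₍₁₎) S(Λ₍₂₎) = x and Λ₍₁₎ λ(S(Λ₍₂₎) y) = y.
  have e3 : ∀ x, antipode k (hitL (lam ∘ₗ LinearMap.mulLeft k x) Lam) = x := by
    intro x
    rw [← h.hitL_mulRight]
    refine Eq.trans ?_ (hitL_counit (k := k) x)
    have : lam ∘ₗ LinearMap.mulRight k Lam = counit :=
      LinearMap.ext fun z => by simp [hL z, h1]
    rw [this]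
  have e4 : ∀ y, hitR (lam ∘ₗ LinearMap.mulRight k y ∘ₗ antipode k) Lam = y := by
    intro y
    rw [← sub_eq_zero]
    refine h.eq_zero' h0 fun x => ?_
    rw [mul_sub, map_sub, sub_eq_zero]
    have := apply_hitL (lam ∘ₗ LinearMap.mulRight k y ∘ₗ antipode k)
      (lam ∘ₗ LinearMap.mulLeft k x) Lam
    simp only [LinearMap.comp_apply, e3, LinearMap.mulRight_apply] at this
    exact this.symm
  -- Expanding y with the Casimir element gives λ(yu) = λ(Λ₍₁₎u) λ(S(Λ₍₂₎) y), while `e2` evaluates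
  -- λ(Λ₍₁₎u) Λ₍₂₎ through the modular function.
  rw [← e2]
  have := apply_hitL (lam ∘ₗ LinearMap.mulRight k y ∘ₗ antipode k)
      (lam ∘ₗ LinearMap.mulRight k u) Lam
  rw [e4] at this
  exact this.symm

end HopfIntegral
end

/-! ### The Casimir element of a Frobenius trace -/

noncomputable section

section Casimir
open Coalgebra HopfAlgebra HopfIntegral LeftComodule

variable {k A : Type u} [Field k] [Ring A] [Algebra k A] [FiniteDimensional k A]
  {lam : A →ₗ[k] k} {V : Type*} [AddCommGroup V] [Module k V]

local notation "𝐞" => Module.finBasis k A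

/-- The basis `eⁱ` dual to the basis `eᵢ` of `A`: `λ(eⁱ eⱼ) = δᵢⱼ`. -/
def IsFrobeniusTrace.dualBasis (hnd : IsFrobeniusTrace lam) :
    Module.Basis (Fin (Module.finrank k A)) k A :=
  LinearMap.BilinForm.dualBasis (traceForm lam) hnd 𝐞

theorem IsFrobeniusTrace.apply_dualBasis_mul (hnd : IsFrobeniusTrace lam)
    (i j : Fin (Module.finrank k A)) :
    lam (hnd.dualBasis i * 𝐞 j) = if j = i then 1 else 0 :=
  LinearMap.BilinForm.apply_dualBasis_left hnd 𝐞 i j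

theorem IsFrobeniusTrace.sum_apply_mul_basis (hnd : IsFrobeniusTrace lam) (a : A) :
    ∑ i, lam (a * 𝐞 i) • hnd.dualBasis i = a := by
  conv_rhs => rw [← hnd.dualBasis.sum_repr a]
  refine Finset.sum_congr rfl fun i _ => ?_
  congr 1
  exact (LinearMap.BilinForm.dualBasis_repr_apply hnd 𝐞 a i).symm

theorem IsFrobeniusTrace.sum_apply_dualBasis_mul (hnd : IsFrobeniusTrace lam) (a : A) :
    ∑ i, lam (hnd.dualBasis i * a) • 𝐞 i = a := by
  conv_rhs => rw [← (𝐞).sum_repr a]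
  refine Finset.sum_congr rfl fun i _ => ?_
  congr 1
  conv_lhs => rw [← (𝐞).sum_repr a]
  simp [Finset.mul_sum, hnd.apply_dualBasis_mul, -Module.Basis.sum_repr]

/-- Moving a linear map across the Casimir element `∑ eᵢ ⊗ eⁱ`. -/
theorem IsFrobeniusTrace.casimir_adjoint (hnd : IsFrobeniusTrace lam) (T : A →ₗ[k] A →ₗ[k] V)
    (φ ψ : A →ₗ[k] A) (h : ∀ x y, lam (x * φ y) = lam (ψ x * y)) :
    ∑ i, T (φ (𝐞 i)) (hnd.dualBasis i) = ∑ i, T (𝐞 i) (ψ (hnd.dualBasis i)) := by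
  have h1 : ∀ i, T (φ (𝐞 i)) (hnd.dualBasis i) =
      ∑ j, lam (ψ (hnd.dualBasis j) * 𝐞 i) • T (𝐞 j) (hnd.dualBasis i) := fun i => by
    conv_lhs => rw [← hnd.sum_apply_dualBasis_mul (φ (𝐞 i))]
    simp [h]
  rw [Finset.sum_congr rfl fun i _ => h1 i, Finset.sum_comm]
  refine Finset.sum_congr rfl fun j _ => ?_
  conv_rhs => rw [← hnd.sum_apply_mul_basis (ψ (hnd.dualBasis j))]
  simp

theorem IsFrobeniusTrace.casimir_mul (hnd : IsFrobeniusTrace lam) (T : A →ₗ[k] A →ₗ[k] V)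
    (a : A) : ∑ i, T (a * 𝐞 i) (hnd.dualBasis i) = ∑ i, T (𝐞 i) (hnd.dualBasis i * a) :=
  hnd.casimir_adjoint T (LinearMap.mulLeft k a) (LinearMap.mulRight k a) fun x y => by
    simp [mul_assoc]

theorem IsFrobeniusTrace.casimir_mul_right (hnd : IsFrobeniusTrace lam)
    (T : A →ₗ[k] A →ₗ[k] V) (a : A) : ∑ i, T (𝐞 i * a) (hnd.dualBasis i) =
      ∑ i, T (𝐞 i) (nakayamaAut lam hnd a * hnd.dualBasis i) :=
  hnd.casimir_adjoint T (LinearMap.mulRight k a) (LinearMap.mulLeft k (nakayamaAut lam hnd a))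
    fun x y => by simp [← mul_assoc, nakayamaAut_spec lam hnd a]

variable {H : Type u} [Ring H] [HopfAlgebra k H] [FiniteDimensional k H]
  [LeftComoduleAlgebra k H A] {g : GroupLike k H}

local notation "𝐛" => Module.finBasis k H
local notation "𝐜" => Module.Basis.coord (Module.finBasis k H)

theorem IsFrobeniusTrace.casimir_hit (hnd : IsFrobeniusTrace lam) (hlam : IsCointegral g lam)
    (T : A →ₗ[k] A →ₗ[k] V) (f : H →ₗ[k] k) : ∑ i, T (hit f (𝐞 i)) (hnd.dualBasis i) =
      ∑ i, T (𝐞 i) (hit (f ∘ₗ LinearMap.mulRight k (g : H) ∘ₗ antipode k) (hnd.dualBasis i)) :=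
  hnd.casimir_adjoint T _ _ fun x y => hlam.apply_mul_hit f x y

/-- ∑ eᵢ ⊗ eⁱ is coinvariant once a factor of degree g⁻¹ is placed between its legs. Moving the
action off eᵢ with `casimir_hit` produces S(·) g, the g cancels g⁻¹, and the antipode identity on eⁱ
remains. -/
theorem IsFrobeniusTrace.casimir_coact (hnd : IsFrobeniusTrace lam) (hlam : IsCointegral g lam)
    (T : A →ₗ[k] A →ₗ[k] V) (f : H →ₗ[k] k) :
    ∑ i, ∑ l, T (hit (f ∘ₗ LinearMap.mulRight k (((g⁻¹ : GroupLike k H) : H) * 𝐛 l)) (𝐞 i))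
      (hit (𝐜 l) (hnd.dualBasis i)) = f 1 • ∑ i, T (𝐞 i) (hnd.dualBasis i) := by
  rw [Finset.sum_comm]
  have h1 := fun l => hnd.casimir_hit hlam (T.compl₂ (hit (𝐜 l)))
    (f ∘ₗ LinearMap.mulRight k (((g⁻¹ : GroupLike k H) : H) * 𝐛 l))
  simp only [LinearMap.compl₂_apply] at h1
  rw [Finset.sum_congr rfl fun l _ => h1 l, Finset.sum_comm, Finset.smul_sum]
  refine Finset.sum_congr rfl fun i _ => ?_
  rw [← map_sum, ← map_smul]
  congr 1
  have h2 := sum_hit_antipode_mul (LinearMap.lsmul k A ∘ₗ f) (hnd.dualBasis i)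
  simp only [LinearMap.comp_apply, LinearMap.lsmul_apply] at h2
  rw [← h2, Finset.sum_comm]
  refine Finset.sum_congr rfl fun l _ => ?_
  rw [hit_eq_sum _ (hnd.dualBasis i), map_sum]
  simp [mul_assoc _ (g : H)]

end Casimir

/-! ### Invariant elements and averaging -/

namespace RelHopfBimod
open Coalgebra HopfAlgebra HopfIntegral LeftComodule

variable {k H A : Type u} [Field k] [Ring H] [HopfAlgebra k H] [FiniteDimensional k H]
  [Ring A] [Algebra k A] [FiniteDimensional k A] [LeftComoduleAlgebra k H A]

local notation "𝐛" => Module.finBasis k H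
local notation "𝐜" => Module.Basis.coord (Module.finBasis k H)
local notation "𝐞" => Module.finBasis k A

theorem toLin_hit {M N : RelHopfBimod k H A A} (φ : M ⟶ N) (f : H →ₗ[k] k) (m : M.carrier) :
    toLin φ (hit f m) = hit f (toLin φ m) := by
  have h := φ.2.2.2 m
  change _ = TensorProduct.lid k N.carrier (f.rTensor N.carrier (coact k H (toLin φ m)))
  rw [toLin, h]
  simp only [hit, LinearMap.comp_apply, LinearEquiv.coe_coe]
  generalize coact k H m = t
  induction t with
  | zero => simp
  | add x y hx hy => simp only [map_add, hx, hy]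
  | tmul a y => simp

/-- Central coinvariant elements, which are the images of `1` under morphisms from `A`. -/
structure IsInvariant (X : RelHopfBimod k H A A) (y : X.carrier) : Prop where
  lact_eq : ∀ a, X.lact a y = X.ract a y
  hit_eq : ∀ f : H →ₗ[k] k, hit f y = f 1 • y

/-- The morphism `A ⟶ X` sending `1` to a given invariant element. -/
def IsInvariant.hom {X : RelHopfBimod k H A A} {y : X.carrier} (h : X.IsInvariant y) :
    unitObj k H A ⟶ X :=
  ⟨X.lact.flip y, by
    have hy : coact k H y = 1 ⊗ₜ[k] y := tensor_ext fun f => by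
      refine (h.hit_eq f).trans ?_
      simp
    have hr : ∀ m b : A, X.lact (m * b) y = X.ract b (X.lact m y) := fun m b => by
      rw [X.mul_lact, h.lact_eq b, X.lact_ract]
    refine ⟨fun a m => X.mul_lact a m y, fun b m => hr m b, fun m => ?_⟩
    · refine (X.coact_lact m y).trans ?_
      rw [hy]
      change _ = LinearMap.lTensor H (X.lact.flip y) (coact k H (M := A) m)
      generalize coact k H (M := A) m = t
      induction t with
      | zero => simp
      | add x y hx hy => simp only [map_add, hx, hy, LinearMap.add_apply]
      | tmul a y => simp⟩

/-- The linear map underlying a morphism from the unit object. -/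
def unitLin {X : RelHopfBimod k H A A} (f : unitObj k H A ⟶ X) : A →ₗ[k] X.carrier := toLin f

theorem unitLin_apply {X : RelHopfBimod k H A A} (f : unitObj k H A ⟶ X) (a : A) :
    unitLin f a = X.lact a (unitLin f 1) := by
  refine Eq.trans ?_ (f.2.1 a (1 : A))
  exact congrArg (unitLin f) (mul_one a).symm

theorem unitObj_hom_ext {X : RelHopfBimod k H A A} {f f' : unitObj k H A ⟶ X}
    (h : unitLin f 1 = unitLin f' 1) : f = f' :=
  hom_ext (LinearMap.ext fun a => (unitLin_apply f a).trans
    ((congrArg (X.lact a) h).trans (unitLin_apply f' a).symm))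

theorem hit_one (f : H →ₗ[k] k) : hit f (1 : A) = f 1 • (1 : A) := by
  rw [hit, LinearMap.comp_apply, LinearMap.comp_apply, LeftComoduleAlgebra.coact_one,
    Algebra.TensorProduct.one_def]
  simp

theorem isInvariant_unitLin_one {X : RelHopfBimod k H A A} (f : unitObj k H A ⟶ X) :
    X.IsInvariant (unitLin f 1) where
  lact_eq a := by
    rw [← unitLin_apply]
    refine Eq.trans ?_ (f.2.2.1 a (1 : A))
    exact congrArg (unitLin f) (one_mul a).symm
  hit_eq F := by
    rw [← map_smul, ← hit_one]
    exact (toLin_hit f F (1 : A)).symm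

section average
variable {lam : A →ₗ[k] k} {g : GroupLike k H} {lamH : H →ₗ[k] k}

/-- The averaging map `x ↦ ∑ eᵢ λ(x₍₋₁₎ g) x₍₀₎ eⁱ`. -/
def average (lamH : H →ₗ[k] k) (g : GroupLike k H) (hnd : IsFrobeniusTrace lam)
    (X : RelHopfBimod k H A A) : X.carrier →ₗ[k] X.carrier :=
  (∑ i, X.ract (hnd.dualBasis i) ∘ₗ X.lact (𝐞 i)) ∘ₗ hit (lamH ∘ₗ LinearMap.mulRight k (g : H))

theorem average_apply (hnd : IsFrobeniusTrace lam) (X : RelHopfBimod k H A A) (x : X.carrier) :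
    average lamH g hnd X x = ∑ i, X.ract (hnd.dualBasis i)
      (X.lact (𝐞 i) (hit (lamH ∘ₗ LinearMap.mulRight k (g : H)) x)) := by
  simp [average]

theorem average_naturality (hnd : IsFrobeniusTrace lam) {X Y : RelHopfBimod k H A A} (f : X ⟶ Y)
    (x : X.carrier) : average lamH g hnd Y (toLin f x) = toLin f (average lamH g hnd X x) := by
  rw [average_apply, average_apply, map_sum]
  refine Finset.sum_congr rfl fun i _ => ?_
  rw [← toLin_hit]
  exact (congrArg (Y.ract (hnd.dualBasis i)) (f.2.1 _ _).symm).trans (f.2.2.1 _ _).symm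

/-- Centrality is the Casimir identity `casimir_mul`. For coinvariance, the cointegral property of
λ_H gives z = λ_H(x₍₋₁₎ g) x₍₀₎ the coaction g⁻¹ ⊗ z, exactly the degree that `casimir_coact` needs
between eᵢ and eⁱ. -/
theorem isInvariant_average (h : IsRightCointegral lamH) (hlam : IsCointegral g lam)
    (hnd : IsFrobeniusTrace lam) (X : RelHopfBimod k H A A) (x : X.carrier) :
    X.IsInvariant (average lamH g hnd X x) where
  lact_eq a := by
    rw [average_apply, map_sum, map_sum]
    have := hnd.casimir_mul (X.ract.flip ∘ₗ
      X.lact.flip (hit (lamH ∘ₗ LinearMap.mulRight k (g : H)) x)) a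
    simp only [LinearMap.comp_apply, LinearMap.flip_apply, X.mul_lact, X.mul_ract] at this
    simpa only [X.lact_ract] using this
  hit_eq f := by
    rw [average_apply, map_sum]
    set z := hit (lamH ∘ₗ LinearMap.mulRight k (g : H)) x with hz
    have h1 : ∀ F : H →ₗ[k] k, hit F z = F ((g⁻¹ : GroupLike k H) : H) • z := by
      intro F
      rw [hz, hit_hit, ← hit_smul]
      refine congrArg (fun f => hit f x) (LinearMap.ext fun y => ?_)
      simp [h.hitL_mulRight_groupLike, mul_comm]
    have h2 := hnd.casimir_coact hlam (X.ract.flip ∘ₗ X.lact.flip z) f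
    simp only [LinearMap.comp_apply, LinearMap.flip_apply] at h2
    rw [← h2]
    refine Finset.sum_congr rfl fun i _ => ?_
    rw [hit_ract]
    refine Finset.sum_congr rfl fun l _ => ?_
    congr 1
    rw [hit_lact, hit_eq_sum _ (𝐞 i), map_sum, LinearMap.sum_apply]
    refine Finset.sum_congr rfl fun j _ => ?_
    rw [h1]
    simp [mul_assoc]

/-- Here λ_H is convolved on the other side, where it yields the distinguished grouplike; the shift
by g contributes g⁻¹. -/
theorem average_hit (h : IsRightCointegral lamH) (hnd : IsFrobeniusTrace lam)
    (X : RelHopfBimod k H A A) (f : H →ₗ[k] k) (x : X.carrier) :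
    average lamH g hnd X (hit f x) =
      f ((distinguishedGrouplike k H * g⁻¹ : GroupLike k H) : H) • average lamH g hnd X x := by
  rw [average, LinearMap.comp_apply, LinearMap.comp_apply, ← map_smul, hit_hit, ← hit_smul]
  refine congrArg (fun f => (∑ i, X.ract (hnd.dualBasis i) ∘ₗ X.lact (𝐞 i)) (hit f x))
    (LinearMap.ext fun y => ?_)
  rw [LinearMap.comp_apply, apply_hitL, h.hitR_mulRight, map_smul]
  simp [mul_comm]

theorem _root_.HopfIntegral.IsRightCointegral.apply_mul' (h : IsRightCointegral lamH) (y u : H) :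
    lamH (y * u) = lamH (antipode k (antipode k
      (hitL (modularFunction k H).toLinearMap u)) * y) := by
  obtain ⟨lam, Lam, h1, h2, h3, h4, -⟩ := exists_integral k H
  obtain ⟨c, rfl⟩ := h1.unique h2 h
  simp only [LinearMap.smul_apply, h1.apply_mul h2 h3 h4 y u]

/-- In `nakayamaAut_hit` the functional is precomposed with h ↦ g⁻¹ S²(h) g. A character does not
see conjugation by g and is invariant under S². -/
theorem nakayamaAut_hit_algHom (hlam : IsCointegral g lam) (hnd : IsFrobeniusTrace lam)
    (α : H →ₐ[k] k) (a : A) : nakayamaAut lam hnd (hit α.toLinearMap a) =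
      hit α.toLinearMap (nakayamaAut lam hnd a) := by
  rw [nakayamaAut_hit hlam]
  congr 2
  ext h
  have h0 : α (antipode k (g : H)) * α (g : H) = 1 := by
    rw [← map_mul, g.2.antipode_mul_cancel, map_one]
  simp only [LinearMap.comp_apply, LinearMap.mulRight_apply, AlgHom.toLinearMap_apply,
    antipode_mul_antidistrib, map_mul, apply_antipode_antipode]
  rw [mul_right_comm, h0, one_mul]

/-- In λ_H(x₍₋₁₎ ν(a)₍₋₁₎ g) the factor after x₍₋₁₎ is moved to the front by the Nakayama
automorphism of H, at the price of α and S². The S² is absorbed by the colinearity defect of ν, and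
the Casimir element then carries ν(a) from the right of x to a on the left. -/
theorem average_ract_nakayamaAut (h : IsRightCointegral lamH) (hlam : IsCointegral g lam)
    (hnd : IsFrobeniusTrace lam) (X : RelHopfBimod k H A A) (a : A) (x : X.carrier) :
    average lamH g hnd X (X.ract (nakayamaAut lam hnd a) x) =
      average lamH g hnd X (X.lact (hit (modularFunction k H).toLinearMap a) x) := by
  set α := modularFunction k H
  set ν := nakayamaAut lam hnd
  let E : H →ₗ[k] A →ₗ[k] X.carrier :=
    X.ract.flip ∘ₗ hitHom x ∘ₗ (LinearMap.mul k H).compr₂ lamH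
  have hE : ∀ u c, E u c = X.ract c (hit (lamH ∘ₗ LinearMap.mulLeft k u) x) := fun u c => rfl
  have e1 : hit (lamH ∘ₗ LinearMap.mulRight k (g : H)) (X.ract (ν a) x) =
      ∑ j, X.ract (ν (hit (𝐜 j) (hit α.toLinearMap a)))
        (hit ((lamH ∘ₗ LinearMap.mulRight k (g : H)) ∘ₗ LinearMap.mulLeft k (𝐛 j)) x) := by
    -- `apply_mul'` with u = ν(a)₍₋₁₎ g. The modular functional splits off the scalar α(g), and S²
    -- fixes g.
    have e1 : hit (lamH ∘ₗ LinearMap.mulRight k (g : H)) (X.ract (ν a) x) =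
        α g • ∑ j, E (antipode k (antipode k (hitL α.toLinearMap (𝐛 j))) * g)
          (hit (𝐜 j) (ν a)) := by
      rw [hit_ract, Finset.smul_sum]
      refine Finset.sum_congr rfl fun j _ => ?_
      rw [hE, ← map_smul, ← hit_smul]
      refine congrArg (fun f => X.ract _ (hit f x)) (LinearMap.ext fun y => ?_)
      simp only [LinearMap.comp_apply, LinearMap.mulRight_apply, LinearMap.smul_apply,
        LinearMap.mulLeft_apply, smul_eq_mul]
      rw [mul_assoc, h.apply_mul', hitL_mul_groupLike]
      simp [antipode_mul_antidistrib, α]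
    -- The remaining modular functional is transposed onto the A-side, where it commutes with ν.
    have e2 : ∑ j, E (antipode k (antipode k (hitL α.toLinearMap (𝐛 j))) * g)
          (hit (𝐜 j) (ν a)) = ∑ j, E (antipode k (antipode k (𝐛 j)) * g)
          (hit (𝐜 j) (ν (hit α.toLinearMap a))) := by
      rw [nakayamaAut_hit_algHom hlam]
      simp only [hit_hit]
      exact (sum_hit_comp (E ∘ₗ LinearMap.mulRight k (g : H) ∘ₗ antipode k ∘ₗ antipode k)
        (hitL α.toLinearMap) (ν a)).symm
    rw [e1, e2, Finset.smul_sum]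
    -- On the target side g alone is moved to the front, giving the same scalar α(g).
    have e3 : ∀ j, X.ract (ν (hit (𝐜 j) (hit α.toLinearMap a)))
        (hit ((lamH ∘ₗ LinearMap.mulRight k (g : H)) ∘ₗ LinearMap.mulLeft k (𝐛 j)) x) =
        α g • E (g * 𝐛 j) (ν (hit (𝐜 j) (hit α.toLinearMap a))) := by
      intro j
      rw [hE, ← map_smul, ← hit_smul]
      refine congrArg (fun f => X.ract _ (hit f x)) (LinearMap.ext fun y => ?_)
      simp only [LinearMap.comp_apply, LinearMap.mulRight_apply, LinearMap.smul_apply,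
        LinearMap.mulLeft_apply, smul_eq_mul]
      have := hitL_mul_groupLike α 1 g
      rw [one_mul] at this
      rw [h.apply_mul', this]
      simp [hitL, Bialgebra.comul_one, Algebra.TensorProduct.one_def, α, mul_assoc]
    rw [Finset.sum_congr rfl fun j _ => e3 j, ← Finset.smul_sum, ← Finset.smul_sum]
    congr 1
    -- The leading g cancels the g⁻¹ in g⁻¹ S²(·) g, so the two sides agree.
    simp only [ν, nakayamaAut_hit hlam]
    refine Eq.trans ?_ (sum_hit_comp (E ∘ₗ LinearMap.mulLeft k (g : H)) _ _).symm
    refine Finset.sum_congr rfl fun j _ => ?_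
    refine congrArg (fun t => E t _) ?_
    simp [antipode_mul_antidistrib, ← mul_assoc]
  rw [average_apply, average_apply, e1, hit_lact]
  simp only [map_sum]
  rw [Finset.sum_comm, Finset.sum_comm (s := Finset.univ (α := Fin (Module.finrank k A)))]
  refine Finset.sum_congr rfl fun j _ => ?_
  set z := hit ((lamH ∘ₗ LinearMap.mulRight k (g : H)) ∘ₗ LinearMap.mulLeft k (𝐛 j)) x
  have := hnd.casimir_mul_right (X.ract.flip ∘ₗ X.lact.flip z) (hit (𝐜 j) (hit α.toLinearMap a))
  simp only [LinearMap.comp_apply, LinearMap.flip_apply, X.mul_lact, X.mul_ract] at this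
  simpa only [X.lact_ract] using this.symm

theorem hit_modularFunction_hit_inv (a : A) : hit (modularFunction k H).toLinearMap
    (hit (modularFunctionInv k H) a) = a := by
  rw [hit_hit]
  refine Eq.trans ?_ (hit_counit (k := k) (H := H) a)
  exact congrArg (fun f => hit f a)
    (LinearMap.ext fun h => apply_hitL_comp_antipode (modularFunction k H) h)

variable (H) in
/-- The map `a ↦ ν²(a ↼ ᾱ)`. -/
def twist (hnd : IsFrobeniusTrace lam) : A →ₗ[k] A :=
  nakayamaAut lam hnd ∘ₗ nakayamaAut lam hnd ∘ₗ hit (modularFunctionInv k H)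

variable (H) in
theorem twist_injective (hnd : IsFrobeniusTrace lam) : Function.Injective (twist H hnd) := by
  refine (nakayamaAut_injective hnd).comp ((nakayamaAut_injective hnd).comp ?_)
  exact Function.LeftInverse.injective hit_modularFunction_hit_inv

/-- One ν of the twist is spent on crossing the average. This produces ↼ α, which commutes with the
other ν and cancels ↼ ᾱ. -/
theorem average_ract_twist (h : IsRightCointegral lamH) (hlam : IsCointegral g lam)
    (hnd : IsFrobeniusTrace lam) (X : RelHopfBimod k H A A) (a : A) (x : X.carrier) :
    average lamH g hnd X (X.ract (twist H hnd a) x) =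
      average lamH g hnd X (X.lact (nakayamaAut lam hnd a) x) := by
  rw [twist, LinearMap.comp_apply, average_ract_nakayamaAut h hlam hnd,
    LinearMap.comp_apply, ← nakayamaAut_hit_algHom hlam, hit_modularFunction_hit_inv]

end average

end RelHopfBimod
end

/-! ### The cofree relative Hopf bimodule A ⊗ A ⊗ H -/

noncomputable section

namespace RelHopfBimod
open Coalgebra HopfAlgebra HopfIntegral LeftComodule

variable {k H A : Type u} [Field k] [Ring H] [HopfAlgebra k H]
  [Ring A] [Algebra k A] [LeftComoduleAlgebra k H A]

variable (k H) in
/-- The regular comodule. -/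
@[reducible]
def regularComodule : LeftComodule k H H where
  coact := comul
  coassoc := coassoc_apply
  counit_coact := rTensor_counit_comul

variable (k H A) in
/-- The coaction as an algebra map. -/
def coactAlgHom : A →ₐ[k] H ⊗[k] A :=
  AlgHom.ofLinearMap (coact k H) LeftComoduleAlgebra.coact_one LeftComoduleAlgebra.coact_mul

variable (k H A) in
/-- The algebra map `a ↦ a₍₀₎ ⊗ 1 ⊗ a₍₋₁₎`. -/
def cofreeLeft : A →ₐ[k] (A ⊗[k] A) ⊗[k] H :=
  ((Algebra.TensorProduct.map Algebra.TensorProduct.includeLeft (AlgHom.id k H)).comp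
    (Algebra.TensorProduct.comm k H A).toAlgHom).comp (coactAlgHom k H A)

variable (k H A) in
/-- The algebra map `a ↦ 1 ⊗ a₍₀₎ ⊗ a₍₋₁₎`. -/
def cofreeRight : A →ₐ[k] (A ⊗[k] A) ⊗[k] H :=
  ((Algebra.TensorProduct.map Algebra.TensorProduct.includeRight (AlgHom.id k H)).comp
    (Algebra.TensorProduct.comm k H A).toAlgHom).comp (coactAlgHom k H A)

/-- The coaction `v ⊗ h ↦ h₍₁₎ ⊗ (v ⊗ h₍₂₎)` on `R ⊗ H`. -/
def cofreeCoact (R : Type u) [Ring R] [Algebra k R] : R ⊗[k] H →ₗ[k] H ⊗[k] (R ⊗[k] H) :=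
  (TensorProduct.leftComm k R H H).toLinearMap ∘ₗ comul.lTensor R

theorem cofreeCoact_mul (R : Type u) [Ring R] [Algebra k R] (x y : R ⊗[k] H) :
    cofreeCoact R (x * y) = cofreeCoact R x * cofreeCoact R y := by
  induction x with
  | zero => simp
  | add x x' hx hx' => simp only [add_mul, map_add, hx, hx']
  | tmul v h =>
    induction y with
    | zero => simp
    | add y y' hy hy' => simp only [mul_add, map_add, hy, hy']
    | tmul w h' =>
      simp only [cofreeCoact, LinearMap.comp_apply, Algebra.TensorProduct.tmul_mul_tmul,
        LinearMap.lTensor_tmul, Bialgebra.comul_mul, LinearEquiv.coe_coe]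
      generalize (comul h : H ⊗[k] H) = s
      generalize (comul h' : H ⊗[k] H) = t
      induction s with
      | zero => simp
      | add x x' hx hx' => simp only [add_mul, TensorProduct.tmul_add, map_add, hx, hx']
      | tmul a b =>
        induction t with
        | zero => simp
        | add y y' hy hy' => simp only [mul_add, TensorProduct.tmul_add, map_add, hy, hy']
        | tmul c d => simp

theorem cofreeCoact_map {R : Type u} [Ring R] [Algebra k R] (φ : A →ₐ[k] R) (a : A) :
    cofreeCoact R ((((Algebra.TensorProduct.map φ (AlgHom.id k H)).comp
      (Algebra.TensorProduct.comm k H A).toAlgHom).comp (coactAlgHom k H A)) a) =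
    (((Algebra.TensorProduct.map φ (AlgHom.id k H)).comp
      (Algebra.TensorProduct.comm k H A).toAlgHom).comp
        (coactAlgHom k H A)).toLinearMap.lTensor H (coact k H a) := by
  have h := congrArg (fun t => LinearMap.lTensor H
    (TensorProduct.map φ.toLinearMap LinearMap.id ∘ₗ (TensorProduct.comm k H A).toLinearMap) t)
    (coassoc (k := k) (H := H) a)
  refine Eq.trans ?_ (h.trans ?_)
  · change cofreeCoact R (TensorProduct.map φ.toLinearMap LinearMap.id
      (TensorProduct.comm k H A (coact k H a))) = _
    generalize coact k H a = t
    induction t with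
    | zero => simp
    | add x y hx hy => simp only [map_add, hx, hy]
    | tmul b x =>
      simp only [TensorProduct.comm_tmul, TensorProduct.map_tmul, cofreeCoact,
        LinearMap.comp_apply, LinearMap.lTensor_tmul, LinearMap.id_apply, LinearEquiv.coe_coe,
        LinearMap.rTensor_tmul]
      generalize (comul b : H ⊗[k] H) = t
      induction t with
      | zero => simp
      | add x y hx hy => simp only [TensorProduct.tmul_add, TensorProduct.add_tmul, map_add, hx, hy]
      | tmul c d => simp
  · rw [← LinearMap.comp_apply, ← LinearMap.lTensor_comp]
    rfl

theorem map₂_mul_left {R : Type u} [Ring R] [Algebra k R] (φ : A →ₐ[k] R) (s : H ⊗[k] A)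
    (t : H ⊗[k] R) : TensorProduct.map₂ (LinearMap.mul k H) (LinearMap.mul k R ∘ₗ φ.toLinearMap)
      s t = φ.toLinearMap.lTensor H s * t := by
  induction s with
  | zero => simp
  | add x y hx hy => simp only [add_mul, map_add, LinearMap.add_apply, hx, hy]
  | tmul h x =>
    induction t with
    | zero => simp
    | add x y hx hy => simp only [mul_add, map_add, hx, hy]
    | tmul h' x' => simp [TensorProduct.map₂_apply_tmul]

theorem map₂_mul_right {R : Type u} [Ring R] [Algebra k R] (φ : A →ₐ[k] R) (s : H ⊗[k] A)
    (t : H ⊗[k] R) : TensorProduct.map₂ (LinearMap.mul k H).flip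
      ((LinearMap.mul k R).flip ∘ₗ φ.toLinearMap) s t = t * φ.toLinearMap.lTensor H s := by
  induction s with
  | zero => simp
  | add x y hx hy => simp only [mul_add, map_add, LinearMap.add_apply, hx, hy]
  | tmul h x =>
    induction t with
    | zero => simp
    | add x y hx hy => simp only [add_mul, map_add, hx, hy]
    | tmul h' x' => simp [TensorProduct.map₂_apply_tmul]

variable [FiniteDimensional k H] [FiniteDimensional k A]

variable (k H A) in
/-- The cofree relative Hopf bimodule `A ⊗ A ⊗ H` on the bimodule `A ⊗ A`, a projective
generator. -/
def cofree : RelHopfBimod k H A A where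
  carrier := (A ⊗[k] A) ⊗[k] H
  comodule := letI := regularComodule k H; copowerComodule (A ⊗[k] A) H
  lact := LinearMap.mul k _ ∘ₗ (cofreeLeft k H A).toLinearMap
  ract := (LinearMap.mul k _).flip ∘ₗ (cofreeRight k H A).toLinearMap
  one_lact := by simp
  mul_lact := by simp [mul_assoc]
  one_ract := by simp
  mul_ract := by simp [mul_assoc]
  lact_ract := by simp [mul_assoc]
  coact_lact a m := by
    rw [map₂_mul_left]
    refine (cofreeCoact_mul _ _ _).trans ?_
    exact congrArg (· * cofreeCoact _ m) (cofreeCoact_map _ a)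
  coact_ract a m := by
    rw [map₂_mul_right]
    refine (cofreeCoact_mul _ _ _).trans ?_
    exact congrArg (cofreeCoact _ m * ·) (cofreeCoact_map _ a)

local notation "𝐛" => Module.finBasis k H
local notation "𝐜" => Module.Basis.coord (Module.finBasis k H)
local notation "𝐞" => Module.finBasis k A

variable (k H A) in
/-- The pure tensor `u ⊗ w ⊗ h` in the cofree relative Hopf bimodule. -/
def cofreeMk : A →ₗ[k] A →ₗ[k] H →ₗ[k] (cofree k H A).carrier :=
  TensorProduct.curry (TensorProduct.mk k (A ⊗[k] A) H)

theorem cofreeMk_apply (u w : A) (h : H) : cofreeMk k H A u w h = (u ⊗ₜ[k] w) ⊗ₜ[k] h := rfl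

theorem cofree_induction {p : (cofree k H A).carrier → Prop} (h0 : p 0)
    (hadd : ∀ x y, p x → p y → p (x + y)) (h : ∀ u w h, p (cofreeMk k H A u w h)) (x) : p x := by
  refine TensorProduct.induction_on x h0 (fun v h' => ?_) hadd
  induction v with
  | zero => rwa [TensorProduct.zero_tmul]
  | add v w hv hw => rw [TensorProduct.add_tmul]; exact hadd _ _ hv hw
  | tmul u w => exact h u w h'

theorem hit_cofreeMk (f : H →ₗ[k] k) (u w : A) (h : H) :
    hit f (cofreeMk k H A u w h) = cofreeMk k H A u w (hitL f h) := by
  change TensorProduct.lid k _ (f.rTensor _ (TensorProduct.leftComm k (A ⊗[k] A) H H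
    ((u ⊗ₜ[k] w) ⊗ₜ[k] comul h))) =
    (u ⊗ₜ[k] w) ⊗ₜ[k] (TensorProduct.lid k H (f.rTensor H (comul h)))
  generalize (comul h : H ⊗[k] H) = t
  induction t with
  | zero => simp
  | add x y hx hy => simp only [TensorProduct.tmul_add, map_add, hx, hy]
  | tmul a b => simp

theorem lact_cofreeMk (a u w : A) (h : H) : (cofree k H A).lact a (cofreeMk k H A u w h) =
    ∑ j, cofreeMk k H A (hit (𝐜 j) a * u) w (𝐛 j * h) := by
  change (TensorProduct.map (Algebra.TensorProduct.includeLeft.toLinearMap) LinearMap.id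
      (TensorProduct.comm k H A (coact k H a))) * ((u ⊗ₜ[k] w) ⊗ₜ[k] h) = _
  rw [coact_eq_sum]
  simp only [map_sum, Finset.sum_mul]
  refine Finset.sum_congr rfl fun j _ => ?_
  simp [cofreeMk_apply]

theorem ract_cofreeMk (a u w : A) (h : H) : (cofree k H A).ract a (cofreeMk k H A u w h) =
    ∑ j, cofreeMk k H A u (w * hit (𝐜 j) a) (h * 𝐛 j) := by
  change ((u ⊗ₜ[k] w) ⊗ₜ[k] h) * (TensorProduct.map
    (Algebra.TensorProduct.includeRight.toLinearMap) LinearMap.id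
      (TensorProduct.comm k H A (coact k H a))) = _
  rw [coact_eq_sum]
  simp only [map_sum, Finset.mul_sum]
  refine Finset.sum_congr rfl fun j _ => ?_
  simp [cofreeMk_apply]

/-- Elements with middle factor 1 generate under the right action: u ⊗ w ⊗ h = (u ⊗ 1 ⊗ h S(w₍₋₁₎))
w₍₀₎. A right linear map thus need only be examined on them, which also dictates the formula for
`fromCofreeLin`. -/
theorem sum_ract_cofreeMk (u w : A) (h : H) : cofreeMk k H A u w h =
    ∑ j, (cofree k H A).ract (hit (𝐜 j) w) (cofreeMk k H A u 1 (h * antipode k (𝐛 j))) := by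
  simp only [ract_cofreeMk, one_mul, mul_assoc]
  have := sum_hit_antipode_mul ((cofreeMk k H A u).flip ∘ₗ LinearMap.mulLeft k h) w
  simpa using this.symm

theorem cofree_induction_one {p : (cofree k H A).carrier → Prop} (h0 : p 0)
    (hadd : ∀ x y, p x → p y → p (x + y))
    (h : ∀ a u h, p ((cofree k H A).ract a (cofreeMk k H A u 1 h))) (x) : p x := by
  refine cofree_induction h0 hadd (fun u w h' => ?_) x
  rw [sum_ract_cofreeMk]
  exact Finset.sum_induction _ p hadd h0 fun j _ => h _ _ _

section map

/-- The linear map out of `A ⊗ A ⊗ H` given by a trilinear map. -/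
def cofreeLift {V : Type*} [AddCommGroup V] [Module k V] (T : A →ₗ[k] A →ₗ[k] H →ₗ[k] V) :
    (cofree k H A).carrier →ₗ[k] V :=
  TensorProduct.lift (TensorProduct.lift T)

theorem cofreeLift_apply {V : Type*} [AddCommGroup V] [Module k V]
    (T : A →ₗ[k] A →ₗ[k] H →ₗ[k] V) (u w : A) (h : H) :
    cofreeLift T (cofreeMk k H A u w h) = T u w h := rfl

variable {lamH : H →ₗ[k] k}

/-- The map `h ↦ λ(S(h) x₍₋₁₎) x₍₀₎`. -/
def hitAntipode (lamH : H →ₗ[k] k) {X : RelHopfBimod k H A A} (x : X.carrier) :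
    H →ₗ[k] X.carrier :=
  hitHom x ∘ₗ (LinearMap.mul k H).compr₂ lamH ∘ₗ antipode k

theorem hitAntipode_apply {X : RelHopfBimod k H A A} (x : X.carrier) (h : H) :
    hitAntipode lamH x h = hit (lamH ∘ₗ LinearMap.mulLeft k (antipode k h)) x := rfl

/-- The linear map underlying the morphism from the cofree relative Hopf bimodule attached to
an element `x`. -/
def fromCofreeLin (lamH : H →ₗ[k] k) (X : RelHopfBimod k H A A) (x : X.carrier) :
    (cofree k H A).carrier →ₗ[k] X.carrier :=
  cofreeLift (∑ j, LinearMap.mk₂ k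
    (fun u w => X.ract (hit (𝐜 j) w) ∘ₗ hitAntipode lamH (X.lact u x) ∘ₗ
        LinearMap.mulRight k (antipode k (𝐛 j)))
    (by intros; ext; simp [hitAntipode, hitHom_apply])
    (by intros; ext; simp [hitAntipode, hitHom_apply])
    (by intros; ext; simp) (by intros; ext; simp))

theorem fromCofreeLin_apply (X : RelHopfBimod k H A A) (x : X.carrier) (u w : A) (h : H) :
    fromCofreeLin lamH X x (cofreeMk k H A u w h) =
      ∑ j, X.ract (hit (𝐜 j) w) (hitAntipode lamH (X.lact u x) (h * antipode k (𝐛 j))) := by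
  rw [fromCofreeLin, cofreeLift_apply]
  simp [LinearMap.sum_apply]

theorem fromCofreeLin_one (X : RelHopfBimod k H A A) (x : X.carrier) (u : A) (h : H) :
    fromCofreeLin lamH X x (cofreeMk k H A u 1 h) = hitAntipode lamH (X.lact u x) h := by
  rw [fromCofreeLin_apply]
  simp only [hit_one, map_smul, LinearMap.smul_apply, X.one_ract]
  refine (sum_smul_right_basis (hitAntipode lamH (X.lact u x) ∘ₗ LinearMap.mulLeft k h ∘ₗ
    antipode k) 1).trans ?_
  simp

/-- S(w₍₋₁₎ a₍₋₁₎) reverses into S(a₍₋₁₎) S(w₍₋₁₎), and the a₍₋₂₎ from the action on the cofree side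
cancels against S(a₍₋₁₎). -/
theorem fromCofreeLin_ract (X : RelHopfBimod k H A A) (x : X.carrier) (a : A)
    (m : (cofree k H A).carrier) :
    fromCofreeLin lamH X x ((cofree k H A).ract a m) = X.ract a (fromCofreeLin lamH X x m) := by
  induction m using cofree_induction with
  | h0 => simp
  | hadd x y hx hy => simp only [map_add, hx, hy]
  | h u w h =>
    simp only [ract_cofreeMk, map_sum, fromCofreeLin_apply]
    set Z := hitAntipode lamH (X.lact u x)
    have h1 := fun j => (unitObj k H A).sum_hit_lact (X.ract.flip ∘ₗ Z ∘ₗ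
      LinearMap.mulLeft k (h * 𝐛 j) ∘ₗ antipode k) w (hit (𝐜 j) a)
    have h2 := fun m => sum_hit_mul_antipode (X.ract.flip ∘ₗ X.ract (hit (𝐜 m) w) ∘ₗ Z ∘ₗ
      LinearMap.mulLeft k h ∘ₗ LinearMap.mulRight k (antipode k (𝐛 m))) a
    refine (Finset.sum_congr rfl fun j _ => h1 j).trans ?_
    rw [Finset.sum_comm]
    refine Finset.sum_congr rfl fun m _ => ?_
    refine Eq.trans ?_ ((h2 m).trans ?_)
    · refine Finset.sum_congr rfl fun j _ => Finset.sum_congr rfl fun l _ => ?_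
      refine (X.mul_ract _ _ _).trans ?_
      simp [mul_assoc, antipode_mul_antidistrib]
      rfl
    · simp

/-- Right linearity and commuting actions reduce this to middle factor 1, where it is `lact_hit`. -/
theorem fromCofreeLin_lact (X : RelHopfBimod k H A A) (x : X.carrier) (a : A)
    (m : (cofree k H A).carrier) :
    fromCofreeLin lamH X x ((cofree k H A).lact a m) = X.lact a (fromCofreeLin lamH X x m) := by
  induction m using cofree_induction_one with
  | h0 => simp
  | hadd x y hx hy => simp only [map_add, hx, hy]
  | h c u h =>
    rw [lact_ract, fromCofreeLin_ract, fromCofreeLin_ract, X.lact_ract, lact_cofreeMk]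
    simp only [map_sum, fromCofreeLin_one]
    rw [← map_sum]
    congr 1
    rw [hitAntipode_apply, lact_hit]
    refine Finset.sum_congr rfl fun j _ => ?_
    rw [hitAntipode_apply, antipode_mul_antidistrib, LinearMap.mulLeft_mul, X.mul_lact]
    rfl

/-- The reduction to middle factor 1 leaves λ(S(h) y₍₁₎) y₍₂₎ = h₍₁₎ λ(S(h₍₂₎) y), the only place in
this construction where λ_H must be a cointegral. -/
theorem fromCofreeLin_hit (hH : IsRightCointegral lamH) (X : RelHopfBimod k H A A) (x : X.carrier)
    (f : H →ₗ[k] k) (m : (cofree k H A).carrier) :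
    fromCofreeLin lamH X x (hit f m) = hit f (fromCofreeLin lamH X x m) := by
  induction m using cofree_induction_one with
  | h0 => simp
  | hadd x y hx hy => simp only [map_add, hx, hy]
  | h c u h =>
    rw [hit_ract, map_sum, fromCofreeLin_ract, hit_ract]
    refine Finset.sum_congr rfl fun j _ => ?_
    rw [fromCofreeLin_ract]
    congr 1
    rw [hit_cofreeMk, fromCofreeLin_one, fromCofreeLin_one, hitAntipode_apply, hitAntipode_apply,
      hit_hit]
    refine congrArg (fun f => hit f (X.lact u x)) (LinearMap.ext fun y => ?_)
    rw [LinearMap.comp_apply _ (hitL _), hH.hitL_mulLeft_antipode, ← apply_hitL]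
    rfl

theorem coact_eq_of_hit {M N : Type u} [AddCommGroup M] [Module k M] [LeftComodule k H M]
    [AddCommGroup N] [Module k N] [LeftComodule k H N] (φ : M →ₗ[k] N)
    (h : ∀ (f : H →ₗ[k] k) m, φ (hit f m) = hit f (φ m)) (m : M) :
    coact k H (φ m) = φ.lTensor H (coact k H m) := by
  rw [coact_eq_sum, coact_eq_sum m]
  simp [h]

/-- The morphism from the cofree relative Hopf bimodule attached to an element `x`. -/
def fromCofree (hH : IsRightCointegral lamH) (X : RelHopfBimod k H A A) (x : X.carrier) :
    cofree k H A ⟶ X :=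
  ⟨fromCofreeLin lamH X x, fromCofreeLin_lact X x, fromCofreeLin_ract X x,
    coact_eq_of_hit _ (fromCofreeLin_hit hH X x)⟩

theorem antipode_leftIntegral_mul {Lam : H} (hL : IsLeftIntegral k Lam) (y : H) :
    antipode k Lam * y = (counit y : k) • antipode k Lam := by
  obtain ⟨z, rfl⟩ := (LinearMap.injective_iff_surjective.1 (antipode_injective (k := k) (H := H))) y
  rw [← antipode_mul_antidistrib, hL, map_smul, HopfAlgebra.counit_antipode]

/-- S(Λ) is a right integral, so λ(S(Λ) y) = ε(y) λ(S(Λ)). If λ vanished at S(Λ), then S(Λ) would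
lie in the radical of a non-degenerate form. -/
theorem apply_antipode_ne_zero (hH : IsRightCointegral lamH) (h0 : lamH ≠ 0) {Lam : H}
    (hL : IsLeftIntegral k Lam) (hL0 : Lam ≠ 0) : lamH (antipode k Lam) ≠ 0 := by
  intro h
  apply hL0
  apply antipode_injective (k := k)
  rw [map_zero]
  refine hH.eq_zero h0 fun y => ?_
  rw [antipode_leftIntegral_mul hL, map_smul, h, smul_zero]

theorem fromCofree_apply (hH : IsRightCointegral lamH) {Lam : H} (hL : IsLeftIntegral k Lam)
    (X : RelHopfBimod k H A A) (x : X.carrier) :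
    toLin (fromCofree hH X x) (cofreeMk k H A 1 1 Lam) = lamH (antipode k Lam) • x := by
  refine (fromCofreeLin_one X x 1 Lam).trans ?_
  rw [X.one_lact, hitAntipode_apply]
  refine Eq.trans ?_ ((hit_smul _ _ _).trans
    (congrArg _ (hit_counit (k := k) (H := H) x)))
  refine congrArg (fun f => hit f x) (LinearMap.ext fun y => ?_)
  simp [antipode_leftIntegral_mul hL, mul_comm]

end map

section invariants
variable {lamH : H →ₗ[k] k} {lam : A →ₗ[k] k} {g : GroupLike k H}

variable (k H A) in
/-- The map `u ⊗ w ⊗ h ↦ ε(h) u ⊗ w`. -/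
def cofreeCounit : (cofree k H A).carrier →ₗ[k] A ⊗[k] A :=
  (TensorProduct.rid k (A ⊗[k] A)).toLinearMap ∘ₗ (counit (R := k) (A := H)).lTensor (A ⊗[k] A)

theorem cofreeCounit_cofreeMk (u w : A) (h : H) :
    cofreeCounit k H A (cofreeMk k H A u w h) = (counit h : k) • (u ⊗ₜ[k] w) := by
  change TensorProduct.rid k (A ⊗[k] A) ((u ⊗ₜ[k] w) ⊗ₜ[k] (counit h : k)) = _
  simp

theorem cofreeCounit_lact (a : A) (m : (cofree k H A).carrier) :
    cofreeCounit k H A ((cofree k H A).lact a m) = (a ⊗ₜ[k] 1) * cofreeCounit k H A m := by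
  induction m using cofree_induction with
  | h0 => simp
  | hadd x y hx hy => simp only [map_add, mul_add, hx, hy]
  | h u w h =>
    simp only [lact_cofreeMk, map_sum, cofreeCounit_cofreeMk, Bialgebra.counit_mul]
    conv_rhs => rw [← hit_counit (k := k) (H := H) a, hit_eq_sum]
    simp [TensorProduct.sum_tmul, Finset.sum_mul, Finset.smul_sum, smul_smul, mul_comm,
      ← TensorProduct.smul_tmul']

theorem cofreeCounit_ract (a : A) (m : (cofree k H A).carrier) :
    cofreeCounit k H A ((cofree k H A).ract a m) = cofreeCounit k H A m * (1 ⊗ₜ[k] a) := by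
  induction m using cofree_induction with
  | h0 => simp
  | hadd x y hx hy => simp only [map_add, add_mul, hx, hy]
  | h u w h =>
    simp only [ract_cofreeMk, map_sum, cofreeCounit_cofreeMk, Bialgebra.counit_mul]
    conv_rhs => rw [← hit_counit (k := k) (H := H) a, hit_eq_sum]
    simp [TensorProduct.tmul_sum, Finset.mul_sum, smul_smul, mul_comm]

/-- Coinvariants of a cofree comodule V ⊗ H are V ⊗ 1, hence determined by the counit: pairing the
H-leg of y with f is the counit of y ↼ f, namely f(1) times the counit of y. -/
theorem IsInvariant.eq_of_cofreeCounit {y z : (cofree k H A).carrier}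
    (hy : (cofree k H A).IsInvariant y) (hz : (cofree k H A).IsInvariant z)
    (h : cofreeCounit k H A y = cofreeCounit k H A z) : y = z := by
  have key : ∀ (f : H →ₗ[k] k) (y : (cofree k H A).carrier), TensorProduct.lid k (A ⊗[k] A)
      (f.rTensor (A ⊗[k] A) (TensorProduct.comm k (A ⊗[k] A) H y)) =
      cofreeCounit k H A (hit f y) := by
    intro f y
    let φ : (cofree k H A).carrier →ₗ[k] A ⊗[k] A := (TensorProduct.lid k (A ⊗[k] A)).toLinearMap ∘ₗ
      f.rTensor (A ⊗[k] A) ∘ₗ (TensorProduct.comm k (A ⊗[k] A) H).toLinearMap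
    change φ y = _
    induction y using cofree_induction with
    | h0 => simp only [map_zero]
    | hadd x y hx hy => simp only [map_add, hx, hy]
    | h u w h =>
      rw [hit_cofreeMk, cofreeCounit_cofreeMk, apply_hitL, hitR_counit, cofreeMk_apply]
      change TensorProduct.lid k (A ⊗[k] A) (f.rTensor (A ⊗[k] A)
        (TensorProduct.comm k (A ⊗[k] A) H ((u ⊗ₜ[k] w) ⊗ₜ[k] h))) = _
      simp
  apply (TensorProduct.comm k (A ⊗[k] A) H).injective
  refine tensor_ext fun f => ?_
  rw [key, key, hy.hit_eq, hz.hit_eq, map_smul, map_smul, h]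

/-- Expanding the second leg of v in eⁱ has coefficients (id ⊗ λ)(v(1 ⊗ eᵢ)), and centrality turns
this into eᵢ · (id ⊗ λ)(v). So the central elements of A ⊗ A are parametrised by A. -/
theorem eq_sum_casimir (hnd : IsFrobeniusTrace lam) {v : A ⊗[k] A}
    (hv : ∀ a : A, (a ⊗ₜ[k] 1) * v = v * (1 ⊗ₜ[k] a)) :
    v = ∑ i, (𝐞 i * TensorProduct.rid k A (lam.lTensor A v)) ⊗ₜ[k] hnd.dualBasis i := by
  have h1 : ∀ v : A ⊗[k] A, v = ∑ i, TensorProduct.rid k A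
      (lam.lTensor A (v * (1 ⊗ₜ[k] 𝐞 i))) ⊗ₜ[k] hnd.dualBasis i := by
    intro v
    induction v with
    | zero => simp
    | add x y hx hy =>
      conv_lhs => rw [hx, hy]
      simp only [add_mul, map_add, TensorProduct.add_tmul, Finset.sum_add_distrib]
    | tmul u w =>
      conv_lhs => rw [← hnd.sum_apply_mul_basis w]
      simp [TensorProduct.tmul_sum, TensorProduct.smul_tmul]
  have h2 : ∀ (a : A) (v : A ⊗[k] A), TensorProduct.rid k A
      (lam.lTensor A ((a ⊗ₜ[k] 1) * v)) = a * TensorProduct.rid k A (lam.lTensor A v) := by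
    intro a v
    induction v with
    | zero => simp
    | add x y hx hy => simp only [mul_add, map_add, hx, hy]
    | tmul u w => simp
  conv_lhs => rw [h1 v]
  simp only [← hv, h2]

theorem cofreeCounit_average (hnd : IsFrobeniusTrace lam) {Lam : H} (hL : IsLeftIntegral k Lam)
    (b : A) : cofreeCounit k H A (average lamH g hnd (cofree k H A)
      ((cofree k H A).lact b (cofreeMk k H A 1 1 Lam))) =
    lamH (Lam * g) • ∑ i, (𝐞 i * b) ⊗ₜ[k] hnd.dualBasis i := by
  -- Acting by b multiplies the H-leg by b₍₋₁₎, which the left integral Λ absorbs through ε.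
  have h1 : (cofree k H A).lact b (cofreeMk k H A 1 1 Lam) = cofreeMk k H A b 1 Lam := by
    rw [lact_cofreeMk]
    conv_rhs => rw [← hit_counit (k := k) (H := H) b, hit_eq_sum]
    simp [hL _]
  rw [h1, average_apply, map_sum, hit_cofreeMk, Finset.smul_sum]
  refine Finset.sum_congr rfl fun i _ => ?_
  rw [cofreeCounit_ract, cofreeCounit_lact, cofreeCounit_cofreeMk, apply_hitL, hitR_counit]
  simp

end invariants
end RelHopfBimod
end

/-! ### The generator, the pairing, and the twisted bimodule structure on A -/

noncomputable section

namespace RelHopfBimod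
open Coalgebra HopfAlgebra HopfIntegral LeftComodule

variable {k H A : Type u} [Field k] [Ring H] [HopfAlgebra k H] [FiniteDimensional k H]
  [Ring A] [Algebra k A] [LeftComoduleAlgebra k H A] [FiniteDimensional k A]

local notation "𝐛" => Module.finBasis k H
local notation "𝐜" => Module.Basis.coord (Module.finBasis k H)
local notation "𝐞" => Module.finBasis k A

variable {lamH : H →ₗ[k] k} {lam : A →ₗ[k] k} {g : GroupLike k H}

/-- The morphism `A ⟶ X` given by the average of an element of `X`. -/
def averageHom (hH : IsRightCointegral lamH) (hlam : IsCointegral g lam)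
    (hnd : IsFrobeniusTrace lam) (X : RelHopfBimod k H A A) :
    X.carrier →ₗ[k] (unitObj k H A ⟶ X) where
  toFun x := (isInvariant_average hH hlam hnd X x).hom
  map_add' x y := hom_ext (LinearMap.ext fun a =>
    (congrArg (X.lact a) (map_add (average lamH g hnd X) x y)).trans (map_add _ _ _))
  map_smul' c x := hom_ext (LinearMap.ext fun a =>
    (congrArg (X.lact a) (map_smul (average lamH g hnd X) c x)).trans (map_smul _ _ _))

theorem unitLin_averageHom_one (hH : IsRightCointegral lamH) (hlam : IsCointegral g lam)
    (hnd : IsFrobeniusTrace lam) (X : RelHopfBimod k H A A) (x : X.carrier) :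
    unitLin (averageHom hH hlam hnd X x) 1 = average lamH g hnd X x :=
  X.one_lact _

theorem averageHom_eq_of {hH : IsRightCointegral lamH} {hlam : IsCointegral g lam}
    {hnd : IsFrobeniusTrace lam} {X : RelHopfBimod k H A A} {x y : X.carrier}
    (h : average lamH g hnd X x = average lamH g hnd X y) :
    averageHom hH hlam hnd X x = averageHom hH hlam hnd X y :=
  unitObj_hom_ext (by rw [unitLin_averageHom_one, unitLin_averageHom_one, h])

theorem averageHom_naturality (hH : IsRightCointegral lamH) (hlam : IsCointegral g lam)
    (hnd : IsFrobeniusTrace lam) {X Y : RelHopfBimod k H A A} (f : X ⟶ Y) (x : X.carrier) :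
    averageHom hH hlam hnd Y (toLin f x) = averageHom hH hlam hnd X x ≫ f :=
  unitObj_hom_ext (by
    rw [unitLin_averageHom_one, average_naturality, ← unitLin_averageHom_one hH hlam]
    rfl)

/-- Morphisms A ⟶ P correspond to invariant elements, which are determined by their counit images.
Those are central in A ⊗ A, so of the form ∑ eᵢ b ⊗ eⁱ, and up to a nonzero scalar they are the
averages of b(1 ⊗ 1 ⊗ Λ). -/
theorem exists_generator (hH : IsRightCointegral lamH) (h0 : lamH ≠ 0) (hlam : IsCointegral g lam)
    (hnd : IsFrobeniusTrace lam) : ∃ (P : RelHopfBimod k H A A) (p : P.carrier)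
      (γ : (unitObj k H A ⟶ P) →ₗ[k] A),
      (∀ b, γ (averageHom hH hlam hnd P (P.lact b p)) = b) ∧
      (∀ f, averageHom hH hlam hnd P (P.lact (γ f) p) = f) ∧
      ∀ (X : RelHopfBimod k H A A) (x : X.carrier), ∃ ρ : P ⟶ X, toLin ρ p = x := by
  obtain ⟨lam', Lam, hlam', -, hL, h1, -⟩ := exists_integral k H
  have hL0 : Lam ≠ 0 := by
    rintro rfl
    simp at h1
  set c := lamH (antipode k Lam)
  have hc : c ≠ 0 := apply_antipode_ne_zero hH h0 hL hL0
  set d := lamH (Lam * g)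
  -- Λg = α_H(g)Λ with α_H(g) invertible. Also λ_H(Λ) ≠ 0, since λ_H(xΛ) = ε(x) λ_H(Λ) and the form
  -- is non-degenerate.
  have hd : d ≠ 0 := by
    have hα : modularFunction k H (g : H) ≠ 0 := fun h => by
      have := congrArg (modularFunction k H) g.2.mul_antipode_cancel
      rw [map_mul, h, zero_mul, map_one] at this
      exact zero_ne_one this
    have hLam : lamH Lam ≠ 0 := fun h => by
      refine hL0 (hH.eq_zero' h0 fun x => ?_)
      rw [hL, map_smul, h, smul_zero]
    simp only [d, modularFunction_spec k H Lam hL, map_smul, smul_eq_mul]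
    exact mul_ne_zero hα hLam
  let γ₀ : A ⊗[k] A →ₗ[k] A := (TensorProduct.rid k A).toLinearMap ∘ₗ lam.lTensor A
  let ev : (unitObj k H A ⟶ cofree k H A) →ₗ[k] (cofree k H A).carrier :=
    { toFun f := unitLin f 1, map_add' _ _ := rfl, map_smul' _ _ := rfl }
  have hav : ∀ b, cofreeCounit k H A (average lamH g hnd (cofree k H A)
      ((cofree k H A).lact b (c⁻¹ • cofreeMk k H A 1 1 Lam))) =
      (c⁻¹ * d) • ∑ i, (𝐞 i * b) ⊗ₜ[k] hnd.dualBasis i := fun b => by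
    rw [map_smul, map_smul, map_smul, cofreeCounit_average hnd hL, smul_smul]
  have hγ₀ : ∀ b, γ₀ (∑ i, (𝐞 i * b) ⊗ₜ[k] hnd.dualBasis i) = b := fun b => by
    have := congrArg (· * b) (hnd.sum_apply_dualBasis_mul 1)
    simp only [mul_one, Finset.sum_mul, one_mul, smul_mul_assoc] at this
    simpa [γ₀] using this
  -- The factor c⁻¹ makes the morphism attached to x send p to x itself. The average of bp then has
  -- counit image c⁻¹d ∑ eᵢ b ⊗ eⁱ, whence the compensating c d⁻¹ in γ.
  refine ⟨cofree k H A, c⁻¹ • cofreeMk k H A 1 1 Lam,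
    (c * d⁻¹) • (γ₀ ∘ₗ cofreeCounit k H A ∘ₗ ev), fun b => ?_, fun f => ?_, fun X x => ?_⟩
  · simp only [LinearMap.smul_apply, LinearMap.comp_apply]
    have : ∀ y, ev (averageHom hH hlam hnd (cofree k H A) y) =
        average lamH g hnd (cofree k H A) y := fun y =>
      unitLin_averageHom_one hH hlam hnd _ y
    rw [this, hav, map_smul, hγ₀, smul_smul]
    rw [show c * d⁻¹ * (c⁻¹ * d) = 1 by field_simp, one_smul]
  · refine unitObj_hom_ext ?_
    rw [unitLin_averageHom_one]
    refine (isInvariant_average hH hlam hnd _ _).eq_of_cofreeCounit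
      (isInvariant_unitLin_one f) ?_
    rw [hav]
    have hv := isInvariant_unitLin_one f
    have := eq_sum_casimir hnd (v := cofreeCounit k H A (unitLin f 1)) fun a => by
      rw [← cofreeCounit_lact, ← cofreeCounit_ract, hv.lact_eq]
    refine Eq.trans ?_ this.symm
    rw [Finset.smul_sum]
    refine Finset.sum_congr rfl fun i _ => ?_
    simp only [LinearMap.smul_apply, mul_smul_comm, ← TensorProduct.smul_tmul', smul_smul]
    rw [show c⁻¹ * d * (c * d⁻¹) = 1 by field_simp, one_smul]
    rfl
  · refine ⟨fromCofree hH X x, ?_⟩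
    rw [map_smul, fromCofree_apply hH hL, smul_smul, inv_mul_cancel₀ hc, one_smul]

/-- The linear isomorphism `A ≃ A^*`, `n ↦ λ(- n)`. -/
def frobeniusEquiv (hnd : IsFrobeniusTrace lam) : A ≃ₗ[k] Module.Dual k A :=
  LinearMap.linearEquivOfInjective ((traceForm lam).flip)
    (fun _ _ h => hnd.ext_right fun b => LinearMap.congr_fun h b)
    (Subspace.dual_finrank_eq (K := k) (V := A)).symm

theorem apply_mul_frobeniusEquiv_symm (hnd : IsFrobeniusTrace lam) (ξ : Module.Dual k A) (b : A) :
    lam (b * (frobeniusEquiv hnd).symm ξ) = ξ b :=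
  LinearMap.congr_fun ((frobeniusEquiv hnd).apply_symm_apply ξ) b

section nakPair
variable (hH : IsRightCointegral lamH) (hlam : IsCointegral g lam) (hnd : IsFrobeniusTrace lam)

/-- The pairing underlying the universal cowedge: `λ(b ⟨ξ, x⟩) = ξ(average (b x))`. -/
def nakPair (X : RelHopfBimod k H A A) (ξ : Module.Dual k (unitObj k H A ⟶ X)) :
    X.carrier →ₗ[k] A :=
  (frobeniusEquiv hnd).symm.toLinearMap ∘ₗ
    X.lact.flip.compr₂ (ξ ∘ₗ averageHom hH hlam hnd X)

theorem apply_mul_nakPair {X : RelHopfBimod k H A A} (ξ : Module.Dual k (unitObj k H A ⟶ X))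
    (x : X.carrier) (b : A) : lam (b * nakPair hH hlam hnd X ξ x) =
      ξ (averageHom hH hlam hnd X (X.lact b x)) :=
  apply_mul_frobeniusEquiv_symm hnd _ b

theorem nakPair_lact {X : RelHopfBimod k H A A} (ξ : Module.Dual k (unitObj k H A ⟶ X))
    (a : A) (x : X.carrier) : nakPair hH hlam hnd X ξ (X.lact a x) =
      a * nakPair hH hlam hnd X ξ x :=
  hnd.ext_right fun b => by
    rw [apply_mul_nakPair, ← mul_assoc, apply_mul_nakPair, X.mul_lact]

/-- λ(b⟨ξ, x⟩a) = λ(ν(a)b⟨ξ, x⟩) = ξ(average of ν(a)bx), and `average_ract_twist` moves ν(a) to the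
right of bx. -/
theorem nakPair_ract_twist {X : RelHopfBimod k H A A} (ξ : Module.Dual k (unitObj k H A ⟶ X))
    (a : A) (x : X.carrier) : nakPair hH hlam hnd X ξ (X.ract (twist H hnd a) x) =
      nakPair hH hlam hnd X ξ x * a :=
  hnd.ext_right fun b => by
    rw [apply_mul_nakPair, ← mul_assoc, nakayamaAut_spec lam hnd, ← mul_assoc, apply_mul_nakPair,
      X.lact_ract, averageHom_eq_of (average_ract_twist hH hlam hnd X a _), X.mul_lact]

variable (g) in
/-- The group-like element `g⁻¹ g_H g⁻¹`. -/
def twistGroupLike : GroupLike k H := g⁻¹ * distinguishedGrouplike k H * g⁻¹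

/-- Rewriting b(x ↼ f) as an action on products and averaging gives f(S(b₍₋₁₎) g_H g⁻¹). On the
other side the adjoint contributes S(b₍₋₁₎) g, so the twist must be g⁻¹ g_H g⁻¹. -/
theorem nakPair_hit {X : RelHopfBimod k H A A} (ξ : Module.Dual k (unitObj k H A ⟶ X))
    (f : H →ₗ[k] k) (x : X.carrier) : nakPair hH hlam hnd X ξ (hit f x) =
      hit (f ∘ₗ LinearMap.mulRight k (twistGroupLike g : H)) (nakPair hH hlam hnd X ξ x) :=
  hnd.ext_right fun b => by
    rw [apply_mul_nakPair, hlam.apply_mul_hit, lact_hit, map_sum, map_sum,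
      hit_eq_sum _ b, Finset.sum_mul, map_sum]
    refine Finset.sum_congr rfl fun i _ => ?_
    have : ∀ (F : H →ₗ[k] k) y, averageHom hH hlam hnd X (hit F y) =
        F ((distinguishedGrouplike k H * g⁻¹ : GroupLike k H) : H) •
          averageHom hH hlam hnd X y := fun F y => by
      rw [← map_smul]
      exact averageHom_eq_of ((average_hit hH hnd X F y).trans (map_smul _ _ _).symm)
    rw [this, map_smul, ← apply_mul_nakPair, smul_mul_assoc, map_smul]
    congr 1
    simp only [LinearMap.comp_apply, LinearMap.mulLeft_apply, LinearMap.mulRight_apply, mul_assoc,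
      ← GroupLike.val_mul, twistGroupLike]
    congr 3
    group

theorem nakPair_naturality {X Y : RelHopfBimod k H A A} (f : X ⟶ Y)
    (ξ : Module.Dual k (unitObj k H A ⟶ Y)) (x : X.carrier) :
    nakPair hH hlam hnd X (dualComp (unitObj k H A) f ξ) x =
      nakPair hH hlam hnd Y ξ (toLin f x) :=
  hnd.ext_right fun b => by
    rw [apply_mul_nakPair, apply_mul_nakPair]
    have : Y.lact b (toLin f x) = toLin f (X.lact b x) := (f.2.1 b x).symm
    rw [this, averageHom_naturality]
    rfl

end nakPair

section transport
variable {N : Type u} [AddCommGroup N] [Module k N] [FiniteDimensional k N]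

/-- Relative Hopf bimodule structure on a vector space which is covered by images of relative
Hopf bimodules under structure preserving maps. -/
def ofCover (δ : N →ₗ[k] H ⊗[k] N) (l r : A →ₗ[k] N →ₗ[k] N)
    (h : ∀ n, ∃ (X : RelHopfBimod k H A A) (φ : X.carrier →ₗ[k] N) (x : X.carrier), φ x = n ∧
      (∀ a m, φ (X.lact a m) = l a (φ m)) ∧ (∀ a m, φ (X.ract a m) = r a (φ m)) ∧
      ∀ m, δ (φ m) = φ.lTensor H (coact k H m)) : RelHopfBimod k H A A where
  carrier := N
  comodule :=
    { coact := δ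
      coassoc n := by
        obtain ⟨X, φ, x, rfl, -, -, hδ⟩ := h n
        rw [hδ]
        have e := congrArg ((φ.lTensor H).lTensor H) (coassoc (k := k) (H := H) x)
        have e1 : δ.lTensor H (φ.lTensor H (coact k H x)) =
            (φ.lTensor H).lTensor H ((coact k H).lTensor H (coact k H x)) := by
          rw [← LinearMap.lTensor_comp_apply, ← LinearMap.lTensor_comp_apply]
          exact congrArg (fun ψ => LinearMap.lTensor H ψ (coact k H x)) (LinearMap.ext hδ)
        rw [e1, ← e]
        generalize coact k H x = t
        induction t with
        | zero => simp
        | add x y hx hy => simp only [map_add, hx, hy]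
        | tmul b x =>
          simp only [LinearMap.lTensor_tmul, LinearMap.rTensor_tmul]
          generalize (comul b : H ⊗[k] H) = t
          induction t with
          | zero => simp
          | add x y hx hy => simp only [TensorProduct.add_tmul, map_add, hx, hy]
          | tmul c d => simp
      counit_coact n := by
        obtain ⟨X, φ, x, rfl, -, -, hδ⟩ := h n
        rw [hδ, ← LinearMap.comp_apply, LinearMap.rTensor_comp_lTensor,
          ← LinearMap.lTensor_comp_rTensor, LinearMap.comp_apply, counit_coact]
        simp }
  lact := l
  ract := r
  one_lact n := by
    obtain ⟨X, φ, x, rfl, hl, -, -⟩ := h n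
    rw [← hl, X.one_lact]
  mul_lact a b n := by
    obtain ⟨X, φ, x, rfl, hl, -, -⟩ := h n
    rw [← hl, ← hl, ← hl, X.mul_lact]
  one_ract n := by
    obtain ⟨X, φ, x, rfl, -, hr, -⟩ := h n
    rw [← hr, X.one_ract]
  mul_ract a b n := by
    obtain ⟨X, φ, x, rfl, -, hr, -⟩ := h n
    rw [← hr, ← hr, ← hr, X.mul_ract]
  lact_ract a b n := by
    obtain ⟨X, φ, x, rfl, hl, hr, -⟩ := h n
    rw [← hl, ← hr, ← hr, ← hl, X.lact_ract]
  coact_lact a n := by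
    obtain ⟨X, φ, x, rfl, hl, -, hδ⟩ := h n
    change δ _ = TensorProduct.map₂ _ _ _ (δ (φ x))
    rw [← hl, hδ, X.coact_lact, hδ]
    generalize coact k H x = t
    generalize coact k H a = s
    induction s with
    | zero => simp
    | add x y hx hy => simp only [map_add, LinearMap.add_apply, hx, hy]
    | tmul h x =>
      induction t with
      | zero => simp
      | add x y hx hy => simp only [map_add, hx, hy]
      | tmul h' x' => simp [TensorProduct.map₂_apply_tmul, hl]
  coact_ract a n := by
    obtain ⟨X, φ, x, rfl, -, hr, hδ⟩ := h n
    change δ _ = TensorProduct.map₂ _ _ _ (δ (φ x))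
    rw [← hr, hδ, X.coact_ract, hδ]
    generalize coact k H x = t
    generalize coact k H a = s
    induction s with
    | zero => simp
    | add x y hx hy => simp only [map_add, LinearMap.add_apply, hx, hy]
    | tmul h x =>
      induction t with
      | zero => simp
      | add x y hx hy => simp only [map_add, hx, hy]
      | tmul h' x' => simp [TensorProduct.map₂_apply_tmul, hr]

end transport

section nakayama
variable (hH : IsRightCointegral lamH) (hlam : IsCointegral g lam) (hnd : IsFrobeniusTrace lam)

variable (H) in
/-- The inverse of `twist`. -/
def twistEquiv (hnd : IsFrobeniusTrace lam) : A ≃ₗ[k] A :=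
  LinearEquiv.ofInjectiveEndo (twist H hnd) (twist_injective H hnd)

theorem twist_twistEquiv_symm (hnd : IsFrobeniusTrace lam) (a : A) :
    twist H hnd ((twistEquiv H hnd).symm a) = a :=
  (twistEquiv H hnd).apply_symm_apply a

variable (k A) in
/-- The coaction `a ↦ a₍₋₁₎ c ⊗ a₍₀₎`. -/
def twistCoact (c : H) : A →ₗ[k] H ⊗[k] A :=
  (LinearMap.mulRight k c).rTensor A ∘ₗ coact k H

theorem lid_rTensor_twistCoact (f : H →ₗ[k] k) (c : H) (a : A) :
    TensorProduct.lid k A (f.rTensor A (twistCoact k A c a)) =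
      hit (f ∘ₗ LinearMap.mulRight k c) a := by
  rw [twistCoact, LinearMap.comp_apply, ← LinearMap.comp_apply (LinearMap.rTensor A f),
    ← LinearMap.rTensor_comp]
  rfl

theorem twistCoact_nakPair {X : RelHopfBimod k H A A} (ξ : Module.Dual k (unitObj k H A ⟶ X))
    (x : X.carrier) : twistCoact k A (twistGroupLike g : H) (nakPair hH hlam hnd X ξ x) =
      (nakPair hH hlam hnd X ξ).lTensor H (coact k H x) :=
  tensor_ext fun f => by
    rw [lid_rTensor_twistCoact, ← nakPair_hit]
    simp only [hit, LinearMap.comp_apply, LinearEquiv.coe_coe]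
    generalize coact k H x = t
    induction t with
    | zero => simp
    | add x y hx hy => simp only [map_add, hx, hy]
    | tmul h y => simp

theorem nakPair_ract {X : RelHopfBimod k H A A} (ξ : Module.Dual k (unitObj k H A ⟶ X))
    (a : A) (x : X.carrier) : nakPair hH hlam hnd X ξ (X.ract a x) =
      nakPair hH hlam hnd X ξ x * (twistEquiv H hnd).symm a := by
  rw [← nakPair_ract_twist, twist_twistEquiv_symm]

/-- The functional λ(γ(·) n) on Hom(A, P), paired with p, returns n. Surjectivity allows the
bimodule and comodule axioms for the twisted structure to be transported through `ofCover`, so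
multiplicativity of the twist is never checked directly. -/
theorem exists_nakPair_eq (h0 : lamH ≠ 0) (n : A) : ∃ (X : RelHopfBimod k H A A)
    (ξ : Module.Dual k (unitObj k H A ⟶ X)) (x : X.carrier), nakPair hH hlam hnd X ξ x = n := by
  obtain ⟨P, p, γ, h1, -, -⟩ := exists_generator hH h0 hlam hnd
  refine ⟨P, lam ∘ₗ LinearMap.mulRight k n ∘ₗ γ, p, hnd.ext_right fun b => ?_⟩
  rw [apply_mul_nakPair]
  simp [h1]

/-- The value of the Nakayama functor at `A`. -/
def nakObj (h0 : lamH ≠ 0) : RelHopfBimod k H A A :=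
  ofCover (twistCoact k A (twistGroupLike g : H)) (LinearMap.mul k A)
    ((LinearMap.mul k A).flip ∘ₗ (twistEquiv H hnd).symm.toLinearMap) fun n => by
      obtain ⟨X, ξ, x, hx⟩ := exists_nakPair_eq hH hlam hnd h0 n
      exact ⟨X, nakPair hH hlam hnd X ξ, x, hx, nakPair_lact hH hlam hnd ξ,
        nakPair_ract hH hlam hnd ξ, twistCoact_nakPair hH hlam hnd ξ⟩

end nakayama

end RelHopfBimod
end

/-! ### Universality of the cowedge, and isomorphisms with the unit object -/

noncomputable section

namespace RelHopfBimod
open Coalgebra HopfAlgebra HopfIntegral LeftComodule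

variable {k H A : Type u} [Field k] [Ring H] [HopfAlgebra k H] [FiniteDimensional k H]
  [Ring A] [Algebra k A] [LeftComoduleAlgebra k H A] [FiniteDimensional k A]

variable {lamH : H →ₗ[k] k} {lam : A →ₗ[k] k} {g : GroupLike k H}

theorem mem_homSubmodule_of_cover {N Z : RelHopfBimod k H A A} (d : N.carrier →ₗ[k] Z.carrier)
    (h : ∀ n, ∃ (X : RelHopfBimod k H A A) (φ : X ⟶ N) (ψ : X ⟶ Z) (x : X.carrier),
      toLin φ x = n ∧ ∀ y, d (toLin φ y) = toLin ψ y) : d ∈ homSubmodule N Z := by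
  refine ⟨fun a n => ?_, fun a n => ?_, fun n => ?_⟩
  · obtain ⟨X, φ, ψ, x, rfl, hd⟩ := h n
    refine (congrArg d (φ.2.1 a x).symm).trans ?_
    rw [hd x]
    exact (hd _).trans (ψ.2.1 a x)
  · obtain ⟨X, φ, ψ, x, rfl, hd⟩ := h n
    refine (congrArg d (φ.2.2.1 a x).symm).trans ?_
    rw [hd x]
    exact (hd _).trans (ψ.2.2.1 a x)
  · obtain ⟨X, φ, ψ, x, rfl, hd⟩ := h n
    rw [hd x]
    refine (ψ.2.2.2 x).trans ?_
    have e : coact k H (toLin φ x) = (toLin φ).lTensor H (coact k H x) := φ.2.2.2 x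
    rw [e, ← LinearMap.lTensor_comp_apply]
    exact congrArg (fun ψ => LinearMap.lTensor H ψ (coact k H x)) (LinearMap.ext hd).symm

section nakayama
variable (hH : IsRightCointegral lamH) (hlam : IsCointegral g lam) (hnd : IsFrobeniusTrace lam)
  (h0 : lamH ≠ 0)

/-- The pairing as a morphism to the Nakayama object. -/
def nakPairHom (X : RelHopfBimod k H A A) (ξ : Module.Dual k (unitObj k H A ⟶ X)) :
    X ⟶ nakObj hH hlam hnd h0 :=
  ⟨nakPair hH hlam hnd X ξ, nakPair_lact hH hlam hnd ξ, nakPair_ract hH hlam hnd ξ,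
    twistCoact_nakPair hH hlam hnd ξ⟩

/-- The legs of the universal cowedge. -/
def nakLeg (X : RelHopfBimod k H A A) :
    copower (Module.Dual k (unitObj k H A ⟶ X)) X ⟶ nakObj hH hlam hnd h0 :=
  (copowerHomEquiv _ X (nakObj hH hlam hnd h0)).symm
    { toFun ξ := nakPairHom hH hlam hnd h0 X ξ
      map_add' ξ η := hom_ext (LinearMap.ext fun x => hnd.ext_right fun b => by
        change lam (b * nakPair hH hlam hnd X _ x) = lam (b * (nakPair hH hlam hnd X ξ x +
          nakPair hH hlam hnd X η x))
        simp [mul_add, apply_mul_nakPair])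
      map_smul' c ξ := hom_ext (LinearMap.ext fun x => hnd.ext_right fun b => by
        change lam (b * nakPair hH hlam hnd X _ x) = lam (b * (c • nakPair hH hlam hnd X ξ x))
        simp [apply_mul_nakPair]) }

/-- The universal cowedge. -/
def nakCowedge : Limits.Cowedge (nakayamaBifunctor (unitObj k H A)) :=
  Limits.Cowedge.mk (nakObj hH hlam hnd h0) (nakLeg hH hlam hnd h0) fun _ _ f =>
    hom_ext (TensorProduct.ext' fun ξ x => nakPair_naturality hH hlam hnd f ξ x)

/-- A cowedge is determined by its leg at P on tensors ξ ⊗ p, because a morphism P ⟶ X carrying p to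
x converts η ⊗ x into such a tensor. The functionals λ(γ(·) n) identify the possible ξ with n ∈ A.
-/
theorem nonempty_isColimit_nakCowedge :
    Nonempty (Limits.IsColimit (nakCowedge hH hlam hnd h0)) := by
  obtain ⟨P, p, γ, h1, h2, h3⟩ := exists_generator hH h0 hlam hnd
  let ξ : A →ₗ[k] Module.Dual k (unitObj k H A ⟶ P) :=
    { toFun n := lam ∘ₗ LinearMap.mulRight k n ∘ₗ γ
      map_add' x y := by ext; simp [mul_add]
      map_smul' c x := by ext; simp }
  have hξ : ∀ n f, ξ n f = lam (γ f * n) := fun n f => rfl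
  have hp : ∀ n, nakPair hH hlam hnd P (ξ n) p = n := fun n => hnd.ext_right fun b => by
    rw [apply_mul_nakPair, hξ, h1]
  -- Choose ρ with ρ(p) = x. The cowedge condition moves ρ to the dual side, and the pulled-back
  -- functional is λ(γ(·) n) with n = ⟨η, x⟩, because every f is the average of γ(f)p.
  have key : ∀ (s : Limits.Cowedge (nakayamaBifunctor (unitObj k H A)))
      (X : RelHopfBimod k H A A) (η : Module.Dual k (unitObj k H A ⟶ X)) (x : X.carrier),
      toLin (s.π P) (ξ (nakPair hH hlam hnd X η x) ⊗ₜ[k] p) = toLin (s.π X) (η ⊗ₜ[k] x) := by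
    intro s X η x
    obtain ⟨ρ, rfl⟩ := h3 X x
    have := congrArg (fun φ => toLin φ (η ⊗ₜ[k] p)) (s.condition ρ)
    refine Eq.trans ?_ this
    change _ = toLin (s.π P) (dualComp (unitObj k H A) ρ η ⊗ₜ[k] p)
    congr 2
    refine LinearMap.ext fun f => ?_
    rw [hξ, apply_mul_nakPair]
    have e : X.lact (γ f) (toLin ρ p) = toLin ρ (P.lact (γ f) p) := (ρ.2.1 _ p).symm
    rw [e, averageHom_naturality, h2]
    rfl
  let d : ∀ s : Limits.Cowedge (nakayamaBifunctor (unitObj k H A)), A →ₗ[k] s.pt.carrier :=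
    fun s => (toLin (s.π P)) ∘ₗ (TensorProduct.mk k _ P.carrier).flip p ∘ₗ ξ
  have hd : ∀ s n, d s n = toLin (s.π P) (ξ n ⊗ₜ[k] p) := fun s n => rfl
  -- The map `d s` is tested on the cover of the Nakayama object by pairings from P; by `key` its
  -- composite with such a pairing is a partial evaluation of the leg at P.
  have hdm : ∀ s, d s ∈ homSubmodule (nakObj hH hlam hnd h0) s.pt := by
    intro s
    exact mem_homSubmodule_of_cover _ fun n => ⟨P, nakPairHom hH hlam hnd h0 P (ξ n),
      copowerHomEquiv _ P s.pt (s.π P) (ξ n), p, hp n, fun x => key s P (ξ n) x⟩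
  exact ⟨Limits.Multicofork.IsColimit.mk _ (fun s => ⟨d s, hdm s⟩)
    (fun s (X : RelHopfBimod k H A A) => hom_ext (TensorProduct.ext' fun η x => key s X η x))
    -- Every n equals ⟨ξ n, p⟩, so the factorisation is determined by the leg at P.
    (fun s m hm => hom_ext (LinearMap.ext fun n => by
      have := congrArg (fun φ => toLin φ (ξ n ⊗ₜ[k] p)) (hm P)
      exact (congrArg (toLin m) (hp n).symm).trans this))⟩

end nakayama

/-- By the Nakayama automorphism of H, λ(· g) is a scalar multiple of λ(g ·). Convolving these forms
gives multiples of g_H g⁻¹ and g⁻¹ g_H respectively, which agree after evaluation at a point where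
λ(· g) is 1. -/
theorem distinguishedGrouplike_mul_comm (g : GroupLike k H) :
    distinguishedGrouplike k H * g⁻¹ = g⁻¹ * distinguishedGrouplike k H := by
  obtain ⟨lam, hlam, h0⟩ := exists_isRightCointegral_ne_zero k H
  obtain ⟨y, hy⟩ := exists_ne_zero_apply h0
  have h1 := hlam.hitR_mulRight (y * antipode k (g : H)) g
  rw [mul_assoc, g.2.antipode_mul_cancel, mul_one, hy, one_smul] at h1
  have h2 : ∀ x, hitR (lam ∘ₗ LinearMap.mulLeft k (g : H)) x =
      lam (g * x) • ((g⁻¹ * distinguishedGrouplike k H : GroupLike k H) : H) := by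
    intro x
    have := congrArg (fun t => antipode k (g : H) * t)
      (distinguishedGrouplike_spec k H lam hlam (g * x))
    rw [mul_smul_comm] at this
    refine Eq.trans ?_ this
    rw [hitR_eq (ℛ k x), hitR, LinearMap.comp_apply, LinearMap.comp_apply, Bialgebra.comul_mul,
      g.2.comul_eq_tmul_self, ← (ℛ k x).eq]
    simp [Finset.mul_sum, ← mul_assoc]
  have h3 : lam ∘ₗ LinearMap.mulRight k (g : H) =
      modularFunction k H g • lam ∘ₗ LinearMap.mulLeft k (g : H) := by
    ext x
    have := hitL_mul_groupLike (modularFunction k H) 1 g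
    rw [one_mul] at this
    simp only [LinearMap.comp_apply, LinearMap.mulRight_apply, LinearMap.smul_apply,
      LinearMap.mulLeft_apply]
    rw [hlam.apply_mul', this]
    simp [hitL, Bialgebra.comul_one, Algebra.TensorProduct.one_def]
  have h4 : ∀ (c : k) (f : H →ₗ[k] k) x, hitR (c • f) x = c • hitR f x := fun c f x => by
    simp [hitR, LinearMap.lTensor_smul]
  have h5 := LinearMap.congr_fun h3 (y * antipode k (g : H))
  simp only [LinearMap.comp_apply, LinearMap.mulRight_apply, LinearMap.smul_apply,
    LinearMap.mulLeft_apply] at h5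
  rw [mul_assoc y, g.2.antipode_mul_cancel, mul_one, hy] at h5
  rw [h3, h4, h2, ← smul_assoc, ← h5, one_smul] at h1
  exact GroupLike.ext h1.symm

theorem twistGroupLike_inv (g : GroupLike k H) :
    (twistGroupLike g)⁻¹ = (distinguishedGrouplike k H)⁻¹ * g ^ 2 := by
  rw [twistGroupLike, mul_assoc, distinguishedGrouplike_mul_comm]
  group

theorem twistCoact_eq_iff (c : GroupLike k H) (a : A) :
    twistCoact k A (c : H) a = 1 ⊗ₜ[k] a ↔
      coact k H a = ((c⁻¹ : GroupLike k H) : H) ⊗ₜ[k] a := by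
  constructor <;> intro h
  · have := congrArg ((LinearMap.mulRight k ((c⁻¹ : GroupLike k H) : H)).rTensor A) h
    rw [twistCoact, LinearMap.comp_apply, ← LinearMap.rTensor_comp_apply,
      ← LinearMap.mulRight_mul] at this
    simpa using this
  · rw [twistCoact, LinearMap.comp_apply, h]
    simp

/-- Left linearity makes both directions of an isomorphism right multiplications by mutually inverse
elements. The unit v is the image of 1 in the twisted object, and the two conditions say precisely
that v is invariant there. -/
theorem nonempty_iso_nakObj_iff (hH : IsRightCointegral lamH) (hlam : IsCointegral g lam)
    (hnd : IsFrobeniusTrace lam) (h0 : lamH ≠ 0) :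
    Nonempty (nakObj hH hlam hnd h0 ≅ unitObj k H A) ↔ ∃ v : Aˣ,
      (∀ a : A, (v : A) * a = twist H hnd a * v) ∧
      twistCoact k A (twistGroupLike g : H) (v : A) = 1 ⊗ₜ[k] (v : A) := by
  constructor
  · rintro ⟨e⟩
    let f : A →ₗ[k] A := toLin e.hom
    let f' : A →ₗ[k] A := unitLin e.inv
    have hf : ∀ n, f n = n * f 1 := fun n =>
      (congrArg f (mul_one n).symm).trans (e.hom.2.1 n (1 : A))
    have hf' : ∀ n, f' n = n * f' 1 := fun n =>
      (congrArg f' (mul_one n).symm).trans (e.inv.2.1 n (1 : A))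
    have h1 : f (f' 1) = 1 := LinearMap.congr_fun (congrArg toLin e.inv_hom_id) (1 : A)
    have h2 : f' (f 1) = 1 := LinearMap.congr_fun (congrArg toLin e.hom_inv_id) (1 : A)
    rw [hf] at h1
    rw [hf'] at h2
    have hr : ∀ a, f ((1 : A) * (twistEquiv H hnd).symm a) = f 1 * a := fun a =>
      e.hom.2.2.1 a (1 : A)
    refine ⟨⟨f' 1, f 1, h1, h2⟩, fun a => ?_, ?_⟩
    · have h3 := hr (twist H hnd a)
      have h4 : (twistEquiv H hnd).symm (twist H hnd a) = a :=
        (twistEquiv H hnd).symm_apply_apply a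
      rw [h4, one_mul, hf] at h3
      change f' 1 * a = _ * f' 1
      -- Right linearity at the twisted element reads a v⁻¹ = v⁻¹ · twist(a); conjugating by v gives
      -- the relation.
      calc f' 1 * a = f' 1 * (a * f 1) * f' 1 := by rw [mul_assoc, mul_assoc, h2, mul_one]
        _ = (f' 1 * f 1) * (twist H hnd a * f' 1) := by rw [h3]; simp only [mul_assoc]
        _ = _ := by rw [h1, one_mul]
    · have h3 : twistCoact k A (twistGroupLike g : H) (f' 1) =
          LinearMap.lTensor H f' (coact k H (1 : A)) := e.inv.2.2.2 (1 : A)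
      rw [LeftComoduleAlgebra.coact_one, Algebra.TensorProduct.one_def,
        LinearMap.lTensor_tmul] at h3
      exact h3
  · rintro ⟨v, hv, hc⟩
    let N := nakObj hH hlam hnd h0
    have hinv : N.IsInvariant (v : A) :=
      { lact_eq a := by
          change a * (v : A) = v * (twistEquiv H hnd).symm a
          rw [hv, twist_twistEquiv_symm]
        hit_eq f := by
          change TensorProduct.lid k A (f.rTensor A (twistCoact k A (twistGroupLike g : H) v)) =
            f 1 • (v : A)
          rw [hc]
          simp }
    let d : A →ₗ[k] A := LinearMap.mulRight k ((v⁻¹ : Aˣ) : A)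
    have hd : ∀ y : A, d (y * v) = y := fun y => by simp [d]
    have hdm : d ∈ homSubmodule N (unitObj k H A) :=
      -- The morphism a ↦ av out of the unit object is already surjective, with n v⁻¹ over n, so its
      -- linear inverse is automatically a morphism.
      mem_homSubmodule_of_cover (N := N) (Z := unitObj k H A) d fun n =>
        ⟨unitObj k H A, hinv.hom, 𝟙 _, HMul.hMul (α := A) (β := A) n ((v⁻¹ : Aˣ) : A),
          Units.inv_mul_cancel_right (α := A) n v, hd⟩
    exact ⟨⟨⟨d, hdm⟩, hinv.hom,
      hom_ext (LinearMap.ext fun n => Units.inv_mul_cancel_right (α := A) n v),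
      hom_ext (LinearMap.ext hd)⟩⟩

theorem isUnimodular_iff (hH : IsRightCointegral lamH) (hlam : IsCointegral g lam)
    (hnd : IsFrobeniusTrace lam) (h0 : lamH ≠ 0) :
    IsUnimodular k H A ↔ Nonempty (nakObj hH hlam hnd h0 ≅ unitObj k H A) := by
  obtain ⟨hc⟩ := nonempty_isColimit_nakCowedge hH hlam hnd h0
  constructor
  · rintro ⟨c, ⟨hc'⟩, ⟨e⟩⟩
    exact ⟨hc.coconePointUniqueUpToIso hc' ≪≫ e⟩
  · intro h
    exact ⟨_, ⟨hc⟩, h⟩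

end RelHopfBimod

end

/-- Let `H` be a finite-dimensional Hopf algebra, `A` a finite-dimensional left `H`-comodule
algebra and `λ_A` a non-degenerate `g_A`-cointegral on `A` with Nakayama automorphism `ν_A`. The
category of relative Hopf bimodules over `A` is unimodular if and only if there is an invertible
`g ∈ A` with `g a = ν_A²(a ↼ ᾱ_H) g` for all `a ∈ A` and `δ_A(g) = g_H⁻¹ g_A² ⊗ g`. -/
theorem mainTheorem10 {k H A : Type u} [Field k] [Ring H] [HopfAlgebra k H]
    [FiniteDimensional k H] [Ring A] [Algebra k A] [FiniteDimensional k A]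
    [LeftComoduleAlgebra k H A] (gA : GroupLike k H) (lamA : A →ₗ[k] k)
    (hlam : IsCointegral gA lamA) (hnd : IsFrobeniusTrace lamA) :
    IsUnimodular k H A ↔ ∃ g : Aˣ,
      (∀ a : A, (g : A) * a = nakayamaAut lamA hnd (nakayamaAut lamA hnd
        (LeftComodule.hit (modularFunctionInv k H) a)) * (g : A)) ∧
      LeftComodule.coact k H (g : A) =
        (((distinguishedGrouplike k H)⁻¹ * gA ^ 2 : GroupLike k H) : H) ⊗ₜ[k] (g : A) := by
  obtain ⟨lamH, hH, h0⟩ := HopfIntegral.exists_isRightCointegral_ne_zero k H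
  rw [RelHopfBimod.isUnimodular_iff hH hlam hnd h0, RelHopfBimod.nonempty_iso_nakObj_iff]
  simp only [RelHopfBimod.twistCoact_eq_iff, RelHopfBimod.twistGroupLike_inv]
  rfl
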